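/- **Model.** Let $T=(V,E)$ be a finite tree with $n=|V|$ nodes. Node $v$ has a block $X_v^B\in\{0,1\}^B$ of $B$ Boolean measurements, and every node has to compute, with zero error and for every input, the block of the $B$ values of a Boolean function $f$ of the $n$ node variables. An interactive strategy $S_B$ for block length $B$ is deterministic and runs over finitely many time slots. In each slot each edge $e=(i,j)$ carries at most one bit: either $i$ transmits on $e$, or $j$ does, or neither, and which of these happens is determined by the slot and the previous transmissions on $e$. The bit that a node transmits may depend on its own measurement block and on all previous transmissions on the edges at that node; at the end each node decodes the function block from its own block and all transmissions on its edges. Let $\mathcal S_B$ be the set of strategies that compute $f$ correctly on all inputs, let $C_e(f,S_B,B)$ be the maximum over all inputs of the total number of bits exchanged on $e$ (in both directions), and let $$C_e(f):=\lim_{B\to\infty}\ \min_{S_B\in\mathcal S_B}\frac{C_e(f,S_B,B)}{B}.$$ **Theorem.** Let $\theta$ be an integer with $0\le\theta\le n+1$, and let $\Pi_\theta$ be the function of the node variables that is $1$ if $\sum_{v\in V}X_v\ge\theta$ and $0$ otherwise. For an edge $e$ let $A_e$ and $V\setminus A_e$ be the two components left by the removal of $e$, named so that $|A_e|\le|V\setminus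 A_e|$. Then: 1. For every $B$, every strategy $S_B\in\mathcal S_B$ and every edge $e$, $$C_e(\Pi_\theta,S_B,B)\ \ge\ B\log_2\min\bigl(2\theta+1,\ 2|A_e|+2,\ 2(n-\theta+1)+1\bigr).$$ 2. For every $B$ and every choice of a root $r\in V$ there is one strategy $S_B^*\in\mathcal S_B$ that satisfies, for all edges $e$ simultaneously, $$C_e(\Pi_\theta,S_B^*,B)\ \le\ \Bigl\lceil B\log_2\min\bigl(2\theta+1,\ 2|A_e|+2,\ 2(n-\theta+1)+1\bigr)\Bigr\rceil ,$$ and $S_B^*$ can be taken to be up-then-down with respect to $r$: on every input, every node first hears from its children, then transmits to its parent, then hears from its parent, and finally transmits to its children. 3. Consequently, for every edge $e$, the limit $C_e(\Pi_\theta)$ exists and $$C_e(\Pi_\theta)=\log_2\min\bigl(2\theta+1,\ 2|A_e|+2,\ 2(n-\theta+1)+1\bigr).$$ -/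

import Mathlib

open Filter Topology

namespace TreeNetwork

/-- A deterministic interactive strategy for blocks of length `B` on the network `G`.

Time is divided into slots `0, 1, …, horizon - 1`. In every slot each edge carries at most one bit,
in one of the two directions; different edges may be used in the same slot or in different slots,
in any order and any number of times.

The argument `List Bool` attached to an edge is always the sequence of bits sent on that edge in
the earlier slots (their times and directions can be recovered from the schedule). -/
structure Strategy {V : Type*} (G : SimpleGraph V) (B : ℕ) where
  /-- The number of slots. -/
  horizon : ℕ
  /-- `schedule e t h` is the endpoint of `e` that transmits on `e` in slot `t` (or nobody). It is
  determined by the slot and by the previous transmissions on `e`, which are what both endpoints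
  of `e` have heard; so neither the direction nor a silence tells an endpoint anything new. -/
  schedule : (e : G.edgeSet) → ℕ → List Bool → Option {v : V // v ∈ e.1}
  /-- `message v e hv t y h` is the bit that `v` transmits on `e` in slot `t`, if the schedule lets
  it transmit: a function of the measurement block `y` of `v` and of all the previous
  transmissions `h` on the edges at `v`. -/
  message : (v : V) → (e : G.edgeSet) → v ∈ e.1 → ℕ → (Fin B → Bool) →
    ({e' : G.edgeSet // v ∈ e'.1} → List Bool) → Bool
  /-- `decode v y h` is the block of function values that `v` computes at the end from its own
  measurement block `y` and all the transmissions `h` on the edges at `v`. -/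
  decode : (v : V) → (Fin B → Bool) → ({e' : G.edgeSet // v ∈ e'.1} → List Bool) → (Fin B → Bool)

namespace Strategy

variable {V : Type*} {G : SimpleGraph V} {B : ℕ}

/-- The bits sent on each edge in the slots before `t`, when `x v` is the measurement block
of `v`. -/
def transcript (S : Strategy G B) (x : V → Fin B → Bool) : ℕ → G.edgeSet → List Bool
  | 0 => fun _ => []
  | t + 1 => fun e =>
    match S.schedule e t (S.transcript x t e) with
    | none => S.transcript x t e
    | some v => S.transcript x t e ++
        [S.message v.1 e v.2 t (x v.1) (fun e' => S.transcript x t e'.1)]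

/-- On input `x`, the node `u` transmits a bit to its neighbour `v` in slot `t`. -/
def Transmits (S : Strategy G B) (x : V → Fin B → Bool) (t : ℕ) (u v : V) : Prop :=
  t < S.horizon ∧ ∃ h : G.Adj u v,
    S.schedule ⟨s(u, v), h⟩ t (S.transcript x t ⟨s(u, v), h⟩) = some ⟨u, Sym2.mem_mk_left u v⟩

/-- Zero-error block computation: on every input, every node decodes all the `B` values of `f`. -/
def Computes (S : Strategy G B) (f : (V → Bool) → Bool) : Prop :=
  ∀ (x : V → Fin B → Bool) (v : V) (k : Fin B),
    S.decode v (x v) (fun e' => S.transcript x S.horizon e'.1) k = f (fun w => x w k)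

/-- The worst-case total number of bits exchanged on the edge `e` (in both directions). -/
def edgeCost [Fintype V] [DecidableEq V] (S : Strategy G B) (e : G.edgeSet) : ℕ :=
  Finset.univ.sup fun x : V → Fin B → Bool => (S.transcript x S.horizon e).length

/-- `S` is an up-then-down strategy with root `r`: on every input, every node first hears from its
children, then transmits to its parent, then hears from its parent, and finally transmits to its
children. (In a tree rooted at `r`, a neighbour of `v` is the parent of `v` if it is closer to `r`
than `v`, and a child of `v` if it is farther from `r` than `v`.) -/
def IsUpDown (S : Strategy G B) (r : V) : Prop :=
  ∀ (x : V → Fin B → Bool) (v : V) (t t' : ℕ),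
    -- hearing from a child precedes transmitting to the parent
    (∀ c p : V, G.dist r v < G.dist r c → G.dist r p < G.dist r v →
      S.Transmits x t c v → S.Transmits x t' v p → t < t') ∧
    -- transmitting to the parent precedes hearing from the parent
    (∀ p : V, G.dist r p < G.dist r v →
      S.Transmits x t v p → S.Transmits x t' p v → t < t') ∧
    -- hearing from the parent precedes transmitting to a child
    (∀ p c : V, G.dist r p < G.dist r v → G.dist r v < G.dist r c →
      S.Transmits x t p v → S.Transmits x t' v c → t < t') ∧
    -- hearing from a child precedes transmitting to a child
    (∀ c c' : V, G.dist r v < G.dist r c → G.dist r v < G.dist r c' →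
      S.Transmits x t c v → S.Transmits x t' v c' → t < t')

end Strategy

/-- The least worst-case number of bits on the edge `e` among all the strategies for blocks of
length `B` that compute `f`. -/
noncomputable def minEdgeCost {V : Type*} [Fintype V] [DecidableEq V] (G : SimpleGraph V)
    (f : (V → Bool) → Bool) (e : G.edgeSet) (B : ℕ) : ℕ :=
  sInf {c : ℕ | ∃ S : Strategy G B, S.Computes f ∧ S.edgeCost e = c}

/-- The worst-case per-instance complexity of computing `f` on the edge `e` exists and is `c`. -/
def HasEdgeComplexity {V : Type*} [Fintype V] [DecidableEq V] (G : SimpleGraph V)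
    (f : (V → Bool) → Bool) (e : G.edgeSet) (c : ℝ) : Prop :=
  Tendsto (fun B : ℕ => (minEdgeCost G f e B : ℝ) / (B : ℝ)) atTop (𝓝 c)

/-- The sum-threshold function with threshold `θ`: it is `1` iff at least `θ` of the variables
are `1`. -/
def sumThreshold {V : Type*} [Fintype V] (θ : ℕ) (x : V → Bool) : Bool :=
  decide (θ ≤ ∑ v, (x v).toNat)

/-- The vertex set of the component of `i` after the removal of the edge `ij`. -/
def side {V : Type*} (G : SimpleGraph V) (i j : V) : Set V :=
  {v | (G.deleteEdges {s(i, j)}).Reachable i v}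

/-- `log₂ min (2θ + 1, 2a + 2, 2(n - θ + 1) + 1)`, computed in the real numbers. -/
noncomputable def thresholdRate (n θ a : ℕ) : ℝ :=
  Real.logb 2 (min (2 * (θ : ℝ) + 1) (min (2 * (a : ℝ) + 2) (2 * ((n : ℝ) - (θ : ℝ) + 1) + 1)))

end TreeNetwork

namespace TreeNetwork

/-! Let an edge separate `d` nodes from `β` nodes. Both bounds rest on one number, `states θ d β`,
which equals the minimum inside the logarithm when `d ≤ β` and `d + β = n` (`thresholdRate_eq`).

Lower bound. The pairs (ones inside, ones outside) with sum `θ` or `θ - 1` form a fooling set of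
size `states θ d β`. Two inputs with the same transcript on the edge can be mixed across the cut
without changing any function value (`Strategy.Computes.value_mix`), and mixing two distinct fooling
pairs does change a value (`fooling_ext`). On blocks this needs `states ^ B` distinct transcripts;
being prefix-free, they remain distinct after padding (`states_pow_le_two_pow_edgeCost`).

Upper bound. Root the tree. Each node sends up the number of ones below it, clipped so that all
counts that force the value `1` are merged, and likewise all counts that force `0`. The reply
carries one bit for each instance still undecided. A clipped count has weight 2 if it is undecided
and 1 otherwise, and these weights again add up to `states θ d β` (`sum_weights`). By the converse
of Kraft's inequality there is a prefix code in which every block's codeword is shorter than `⌈log₂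
(states ^ B)⌉` by exactly the length of its reply (`exists_block_code`). The total on an edge is
then this number on every input. Clipped counts suffice because those of the branches at a node
determine that of their union (`clip_add_sum_eq`). -/

/-! ### Prefix codes -/

/-- The Boolean words of length `m`. -/
def words (m : ℕ) : Finset (List Bool) :=
  Finset.univ.image fun g : Fin m → Bool => List.ofFn g

theorem mem_words {m : ℕ} {w : List Bool} : w ∈ words m ↔ w.length = m := by
  constructor
  · intro h
    obtain ⟨g, -, rfl⟩ := Finset.mem_image.1 h
    simp
  · rintro rfl
    exact Finset.mem_image.2 ⟨w.get, Finset.mem_univ _, List.ofFn_get w⟩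

theorem card_words (m : ℕ) : (words m).card = 2 ^ m := by
  rw [words, Finset.card_image_of_injective _ List.ofFn_injective]
  simp

/-- The converse of Kraft's inequality, on a finite set. -/
theorem exists_prefix_code_on {ι : Type*} [DecidableEq ι] (k : ι → ℕ) (N : ℕ) (s : Finset ι) :
    ∑ i ∈ s, 2 ^ k i ≤ 2 ^ N → ∃ c : ι → List Bool, (∀ i ∈ s, (c i).length + k i = N) ∧
      ∀ i ∈ s, ∀ j ∈ s, c i <+: c j → i = j := by
  -- Minimality of `k a` among the indices means that codewords are chosen in order of increasing
  -- length.
  induction s using Finset.induction_on_min_value k with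
  | empty => exact fun _ => ⟨fun _ => [], by simp, by simp⟩
  | insert a s ha hmin ih =>
    intro hsum
    rw [Finset.sum_insert ha] at hsum
    obtain ⟨c, hlen, hpre⟩ := ih ((Nat.le_add_left _ _).trans hsum)
    have hpos : 0 < 2 ^ k a := by positivity
    have hkN : k a ≤ N := (Nat.pow_le_pow_iff_right (by norm_num : 1 < 2)).1 ((Nat.le_add_right _ _).trans hsum)
    -- The words of length `N - k a` that extend an earlier codeword. The Kraft sum leaves room for
    -- one word outside this set.
    let bad : Finset (List Bool) := s.biUnion fun i => (words (k i - k a)).image (c i ++ ·)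
    have hbad : bad.card < (words (N - k a)).card := by
      have h1 : bad.card ≤ ∑ i ∈ s, 2 ^ (k i - k a) :=
        Finset.card_biUnion_le.trans <| Finset.sum_le_sum fun i _ =>
          Finset.card_image_le.trans (card_words _).le
      have h2 : (∑ i ∈ s, 2 ^ (k i - k a)) * 2 ^ k a = ∑ i ∈ s, 2 ^ k i := by
        rw [Finset.sum_mul]
        refine Finset.sum_congr rfl fun i hi => ?_
        rw [← pow_add, Nat.sub_add_cancel (hmin i hi)]
      have h3 : 2 ^ (N - k a) * 2 ^ k a = 2 ^ N := by rw [← pow_add, Nat.sub_add_cancel hkN]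
      rw [card_words]
      refine h1.trans_lt (lt_of_mul_lt_mul_right (a := 2 ^ k a) ?_ hpos.le)
      omega
    obtain ⟨w, hw, hwb⟩ := Finset.exists_mem_notMem_of_card_lt_card hbad
    rw [mem_words] at hw
    have hnot : ∀ i ∈ s, ¬ c i <+: w := by
      rintro i hi ⟨t, ht⟩
      refine hwb (Finset.mem_biUnion.2 ⟨i, hi, Finset.mem_image.2 ⟨t, mem_words.2 ?_, ht⟩⟩)
      have := congrArg List.length ht
      have := hlen i hi
      simp only [List.length_append] at *
      omega
    have hne : ∀ i ∈ s, i ≠ a := fun i hi h => ha (h ▸ hi)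
    refine ⟨Function.update c a w, ?_, ?_⟩
    · intro i hi
      rcases Finset.mem_insert.1 hi with rfl | hi
      · simp; omega
      · rw [Function.update_of_ne (hne i hi)]; exact hlen i hi
    · intro i hi j hj hij
      rcases Finset.mem_insert.1 hi with rfl | hi' <;> rcases Finset.mem_insert.1 hj with rfl | hj'
      · rfl
      · rw [Function.update_self, Function.update_of_ne (hne j hj')] at hij
        -- The new word is at least as long as `c j`, so it could be a prefix only by being equal,
        -- which `hnot` excludes.
        have h1 := hij.length_le
        have h2 := hlen j hj'
        have h3 := hmin j hj'
        have := hij.eq_of_length (by omega)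
        exact (hnot j hj' (this ▸ List.prefix_rfl)).elim
      · rw [Function.update_self, Function.update_of_ne (hne i hi')] at hij
        exact (hnot i hi' hij).elim
      · rw [Function.update_of_ne (hne i hi'), Function.update_of_ne (hne j hj')] at hij
        exact hpre i hi' j hj' hij

/-! ### Clipped counts and their weights -/

/-- The number `min (2θ + 1, 2 min (d, β) + 2, 2(d + β - θ + 1) + 1)` of value pairs that an edge
has to distinguish when it separates `d` nodes from `β` nodes. -/
def states (θ d β : ℕ) : ℕ :=
  (min d θ + 1 - (θ - β)) + (min (d + 1) θ - (θ - (β + 1)))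

/-- Lets the bound refer to either endpoint of an edge, although the protocol always codes the side
away from the root. -/
theorem states_comm {θ d β : ℕ} (h : θ ≤ d + β + 1) : states θ d β = states θ β d := by
  unfold states; omega

theorem thresholdRate_eq {n θ d β : ℕ} (hn : d + β = n) (h : θ ≤ n + 1) (hd : d ≤ β) :
    thresholdRate n θ d = Real.logb 2 (states θ d β) := by
  subst hn
  have h1 : states θ d β = min (2 * θ + 1) (min (2 * d + 2) (2 * (d + β + 1 - θ) + 1)) := by
    unfold states; omega
  rw [thresholdRate, h1]
  push_cast [Nat.cast_sub h]
  congr 4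
  ring

/-- The part of the number `c` of ones in a subtree that matters for the threshold `θ` when there
are `β` nodes outside the subtree: `θ` if the function is certainly `1`, `θ - (β + 1)` if it is
certainly `0`, and `c` itself otherwise. -/
def clip (θ β c : ℕ) : ℕ := min θ (max c (θ - (β + 1)))

/-- The function value is not yet determined by the number `c` of ones in a subtree with `β` nodes
outside. -/
def Pending (θ β c : ℕ) : Prop := θ ≤ c + β ∧ c < θ

instance (θ β c : ℕ) : Decidable (Pending θ β c) := inferInstanceAs (Decidable (_ ∧ _))

theorem clip_mem {θ d β c : ℕ} (hc : c ≤ d) (h : θ ≤ d + β + 1) :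
    clip θ β c ∈ Finset.Icc (θ - (β + 1)) (min θ d) := by
  rw [Finset.mem_Icc, clip]; omega

theorem pending_clip {θ β c : ℕ} : Pending θ β (clip θ β c) ↔ Pending θ β c := by
  unfold Pending clip; omega

theorem le_iff_of_clip_eq {θ β c c' : ℕ} (h : clip θ β c = clip θ β c') : θ ≤ c ↔ θ ≤ c' := by
  unfold clip at h; omega

theorem le_add_iff_of_not_pending {θ β c y : ℕ} (hy : y ≤ β) (h : ¬ Pending θ β c) :
    θ ≤ c + y ↔ θ ≤ c := by
  unfold Pending at h; omega

/-- The identity that makes the two bounds meet: an undecided clipped count costs one reply bit,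
hence weight 2, and the total weight is the size of the fooling set. -/
theorem sum_weights {θ d β : ℕ} (h : θ ≤ d + β + 1) :
    ∑ l ∈ Finset.Icc (θ - (β + 1)) (min θ d), (if Pending θ β l then 2 else 1) =
      states θ d β := by
  have h1 : ∀ l, (if Pending θ β l then 2 else 1) = 1 + (if Pending θ β l then 1 else 0) := by
    intro l; split_ifs <;> rfl
  have h2 : (Finset.Icc (θ - (β + 1)) (min θ d)).filter (Pending θ β) =
      Finset.Ico (θ - β) (min (d + 1) θ) := by
    ext l
    simp only [Finset.mem_filter, Finset.mem_Icc, Finset.mem_Ico, Pending]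
    omega
  simp only [h1, Finset.sum_add_distrib, Finset.sum_boole, h2]
  simp only [Finset.sum_const, Nat.card_Icc, Nat.card_Ico, smul_eq_mul, Nat.cast_id, states]
  omega

/-- Clipped counts of the parts determine the clipped count of the whole. -/
theorem clip_add_sum_eq {ι : Type*} (s : Finset ι) (c c' b : ι → ℕ) (m β θ : ℕ)
    (h : ∀ i ∈ s, clip θ (b i) (c i) = clip θ (b i) (c' i))
    (hb : ∀ i ∈ s, m + ∑ i ∈ s, c i + β ≤ c i + b i)
    (hb' : ∀ i ∈ s, m + ∑ i ∈ s, c' i + β ≤ c' i + b i) :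
    clip θ β (m + ∑ i ∈ s, c i) = clip θ β (m + ∑ i ∈ s, c' i) := by
  by_cases hp : ∀ i ∈ s, Pending θ (b i) (c i)
  -- Clipping does not alter an undecided count, so all the parts have equal true counts.
  · rw [Finset.sum_congr rfl fun i hi => ?_]
    have h1 := h i hi
    have h2 := hp i hi
    unfold Pending at h2
    unfold clip at h1
    omega
  -- One part is decided. If it alone reaches `θ`, so does the whole; otherwise `hb` and `hb'` carry
  -- its certain `0` over to the whole. Either way both totals clip to the same extreme.
  · push Not at hp
    obtain ⟨i, hi, hp⟩ := hp
    have h1 := h i hi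
    have h2 := hb i hi
    have h3 := hb' i hi
    have h4 := Finset.single_le_sum (f := c) (fun _ _ => Nat.zero_le _) hi
    have h5 := Finset.single_le_sum (f := c') (fun _ _ => Nat.zero_le _) hi
    unfold Pending at hp
    unfold clip at h1 ⊢
    omega

/-- Two words of at most `C` bits that agree after padding to length `C` are comparable. -/
theorem eq_of_getD_eq {C : ℕ} {l l' : List Bool} (hl : l.length ≤ C) (hl' : l'.length ≤ C)
    (h : ∀ k < C, l.getD k false = l'.getD k false) : l <+: l' ∨ l' <+: l := by
  wlog hle : l.length ≤ l'.length generalizing l l'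
  · exact (this hl' hl (fun k hk => (h k hk).symm) (by omega)).symm
  left
  rw [List.prefix_iff_eq_take]
  refine List.ext_getElem (by simp [hle]) fun k hk hk' => ?_
  have := h k (by omega)
  rw [List.getD_eq_getElem _ _ hk, List.getD_eq_getElem _ _ (by omega)] at this
  simpa using this

/-! ### Cuts and branches of a tree -/

section Tree

variable {V : Type*} {G : SimpleGraph V}

theorem mem_side_self (i j : V) : i ∈ side G i j := SimpleGraph.Reachable.refl i

theorem mem_side_of_adj {i j a b : V} (hab : G.Adj a b) (hne : s(a, b) ≠ s(i, j))
    (ha : a ∈ side G i j) : b ∈ side G i j := by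
  refine SimpleGraph.Reachable.trans ha (SimpleGraph.Adj.reachable ?_)
  rw [SimpleGraph.deleteEdges_adj]
  exact ⟨hab, hne⟩

theorem not_reachable_of_adj (hG : G.IsAcyclic) {i j : V} (hij : G.Adj i j) :
    ¬ (G.deleteEdges {s(i, j)}).Reachable i j := by
  have := SimpleGraph.isAcyclic_iff_forall_adj_isBridge.1 hG hij
  exact (SimpleGraph.isBridge_iff.1 this)

/-- Along a walk from `i`, an edge other than `ij` preserves the side and `ij` itself leads to one
of its endpoints, so the two sides cover the tree. They are disjoint because `ij` is a bridge. -/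
theorem compl_side (hG : G.IsTree) {i j : V} (hij : G.Adj i j) :
    (side G i j)ᶜ = side G j i := by
  ext w
  have hswap : side G j i = {v | (G.deleteEdges {s(i, j)}).Reachable j v} := by
    rw [side, Sym2.eq_swap]
  constructor
  · intro hw
    have key : ∀ w, G.Walk i w → w ∈ side G i j ∨ w ∈ side G j i := by
      intro w p
      induction p using SimpleGraph.Walk.concatRec with
      | Hnil => exact Or.inl (mem_side_self _ _)
      | @Hconcat i a b p h ih =>
        by_cases hab : s(a, b) = s(i, j)
        · rcases Sym2.eq_iff.1 hab with ⟨-, rfl⟩ | ⟨-, rfl⟩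
          · exact Or.inr (mem_side_self _ _)
          · exact Or.inl (mem_side_self _ _)
        · rcases ih hij hswap hw with h1 | h1
          · exact Or.inl (mem_side_of_adj h hab h1)
          · exact Or.inr (mem_side_of_adj h (by rwa [Sym2.eq_swap (a := j)]) h1)
    obtain ⟨p⟩ := hG.connected.preconnected i w
    exact (key w p).resolve_left hw
  · intro hw hw'
    rw [hswap] at hw
    exact not_reachable_of_adj hG.isAcyclic hij (SimpleGraph.Reachable.trans hw' hw.symm)

theorem exists_path_of_mem_side (hG : G.IsAcyclic) {u v w : V} (h : G.Adj v u)
    (hw : w ∈ side G u v) : ∃ p : G.Walk u w, (SimpleGraph.Walk.cons h p).IsPath := by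
  classical
  obtain ⟨q⟩ := hw
  let q' := q.toPath
  refine ⟨q'.1.mapLe (SimpleGraph.deleteEdges_le _), ?_⟩
  rw [SimpleGraph.Walk.cons_isPath_iff]
  refine ⟨q'.2.mapLe _, fun hv => not_reachable_of_adj hG h.symm ?_⟩
  rw [SimpleGraph.Walk.support_mapLe_eq_support] at hv
  exact ⟨q'.1.takeUntil v hv⟩

theorem mem_side_of_path {u v w : V} (h : G.Adj v u) (p : G.Walk u w)
    (hp : (SimpleGraph.Walk.cons h p).IsPath) : w ∈ side G u v := by
  rw [SimpleGraph.Walk.cons_isPath_iff] at hp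
  refine ⟨p.toDeleteEdges _ fun e he hmem => hp.2 ?_⟩
  rw [Set.mem_singleton_iff] at hmem
  subst hmem
  exact p.snd_mem_support_of_mem_edges he

/-- The branch at `v` that contains `w` is the one entered by the first step of the unique path from
`v` to `w`. -/
theorem existsUnique_mem_side (hG : G.IsTree) {v w : V} (hvw : v ≠ w) :
    ∃! u, G.Adj v u ∧ w ∈ side G u v := by
  obtain ⟨p, hp, huniq⟩ := hG.existsUnique_path v w
  cases p with
  | nil => exact (hvw rfl).elim
  | @cons _ u _ h p =>
    refine ⟨u, ⟨h, mem_side_of_path h p hp⟩, ?_⟩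
    rintro u' ⟨h', hw'⟩
    obtain ⟨p', hp'⟩ := exists_path_of_mem_side hG.isAcyclic h' hw'
    have := huniq _ hp'
    injection this

theorem dist_lt_of_mem_side (hG : G.IsTree) {u v w : V} (h : G.Adj v u) (hw : w ∈ side G u v) :
    G.dist w u < G.dist w v := by
  obtain ⟨p, hp⟩ := hG.connected.exists_walk_length_eq_dist v w
  have hpath := p.isPath_of_length_eq_dist hp
  cases p with
  | nil => exact (not_reachable_of_adj hG.isAcyclic h.symm hw).elim
  | @cons _ u' _ h' p =>
    have := (existsUnique_mem_side hG (v := v) (w := w) ?_).unique ⟨h, hw⟩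
      ⟨h', mem_side_of_path h' p hpath⟩
    · subst this
      have := SimpleGraph.dist_le p
      rw [SimpleGraph.dist_comm (v := u), SimpleGraph.dist_comm (v := v), ← hp,
        SimpleGraph.Walk.length_cons]
      omega
    · rintro rfl
      exact not_reachable_of_adj hG.isAcyclic h.symm hw

/-- With `w` the root, this translates between distances to the root and sides of cuts. -/
theorem mem_side_iff_dist_lt (hG : G.IsTree) {u v w : V} (h : G.Adj v u) :
    w ∈ side G u v ↔ G.dist w u < G.dist w v := by
  refine ⟨dist_lt_of_mem_side hG h, fun hlt => ?_⟩
  by_contra hw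
  have hw' : w ∈ side G v u := by rw [← compl_side hG h.symm]; exact hw
  have := dist_lt_of_mem_side hG h.symm hw'
  omega

variable [Fintype V]

open Classical in
/-- The component of `i` after the removal of the edge `ij`, as a finite set. -/
noncomputable def sideFinset (G : SimpleGraph V) (i j : V) : Finset V :=
  Finset.univ.filter (· ∈ side G i j)

theorem mem_sideFinset {i j w : V} : w ∈ sideFinset G i j ↔ w ∈ side G i j := by
  simp [sideFinset]

theorem card_sideFinset (i j : V) : (sideFinset G i j).card = (side G i j).ncard := by
  rw [← Set.ncard_coe_finset]
  congr 1
  ext w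
  simp [mem_sideFinset]

theorem card_sideFinset_add (hG : G.IsTree) {i j : V} (hij : G.Adj i j) :
    (sideFinset G i j).card + (sideFinset G j i).card = Fintype.card V := by
  classical
  have : sideFinset G j i = (sideFinset G i j)ᶜ := by
    ext w
    rw [Finset.mem_compl, mem_sideFinset, mem_sideFinset, ← compl_side hG hij, Set.mem_compl_iff]
  rw [this, Finset.card_add_card_compl]

theorem sum_sideFinset_add (hG : G.IsTree) {i j : V} (hij : G.Adj i j) (f : V → ℕ) :
    ∑ w ∈ sideFinset G i j, f w + ∑ w ∈ sideFinset G j i, f w = ∑ w, f w := by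
  classical
  have : sideFinset G j i = (sideFinset G i j)ᶜ := by
    ext w
    rw [Finset.mem_compl, mem_sideFinset, mem_sideFinset, ← compl_side hG hij, Set.mem_compl_iff]
  rw [this, Finset.sum_add_sum_compl]

open Classical in
/-- Around a node `v`, the tree splits into `v` and one branch for each neighbour of `v`. -/
theorem sum_eq_add_sum_branches (hG : G.IsTree) (v : V) (f : V → ℕ) :
    ∑ w, f w = f v + ∑ u ∈ Finset.univ.filter (G.Adj v), ∑ w ∈ sideFinset G u v, f w := by
  rw [← Finset.sum_erase_add _ _ (Finset.mem_univ v), add_comm]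
  congr 1
  rw [← Finset.sum_biUnion]
  · refine Finset.sum_congr ?_ fun _ _ => rfl
    ext w
    simp only [Finset.mem_erase, Finset.mem_univ, and_true, Finset.mem_biUnion, Finset.mem_filter,
      true_and, mem_sideFinset]
    constructor
    · intro hw
      exact (existsUnique_mem_side hG (Ne.symm hw)).exists
    · rintro ⟨u, h, hw⟩ rfl
      exact not_reachable_of_adj hG.isAcyclic h.symm hw
  · intro u hu u' hu' hne
    rw [Function.onFun, Finset.disjoint_left]
    intro w hw hw'
    rw [mem_sideFinset] at hw hw'
    have h1 : G.Adj v u := by simpa using hu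
    have h2 : G.Adj v u' := by simpa using hu'
    refine hne ((existsUnique_mem_side hG (v := v) (w := w) ?_).unique ⟨h1, hw⟩ ⟨h2, hw'⟩)
    rintro rfl
    exact not_reachable_of_adj hG.isAcyclic h1.symm hw

end Tree

/-! ### Transcripts and the rectangle property -/

namespace Strategy

variable {V : Type*} {G : SimpleGraph V} {B : ℕ}

theorem transcript_succ_of_none (S : Strategy G B) {x : V → Fin B → Bool} {t : ℕ} {e : G.edgeSet}
    (h : S.schedule e t (S.transcript x t e) = none) :
    S.transcript x (t + 1) e = S.transcript x t e := by
  simp only [transcript, h]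

theorem transcript_succ_of_some (S : Strategy G B) {x : V → Fin B → Bool} {t : ℕ} {e : G.edgeSet}
    {v : {v : V // v ∈ e.1}} (h : S.schedule e t (S.transcript x t e) = some v) :
    S.transcript x (t + 1) e = S.transcript x t e ++
      [S.message v.1 e v.2 t (x v.1) (fun e' => S.transcript x t e'.1)] := by
  simp only [transcript, h]

theorem transcript_prefix_succ (S : Strategy G B) (x : V → Fin B → Bool) (t : ℕ) (e : G.edgeSet) :
    S.transcript x t e <+: S.transcript x (t + 1) e := by
  cases h : S.schedule e t (S.transcript x t e) with
  | none => rw [S.transcript_succ_of_none h]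
  | some v => rw [S.transcript_succ_of_some h]; exact List.prefix_append _ _

theorem transcript_prefix (S : Strategy G B) (x : V → Fin B → Bool) {t t' : ℕ} (htt' : t ≤ t')
    (e : G.edgeSet) : S.transcript x t e <+: S.transcript x t' e := by
  induction t', htt' using Nat.le_induction with
  | base => exact List.prefix_rfl
  | succ t' _ ih => exact ih.trans (S.transcript_prefix_succ x t' e)

/-- The transcripts of an edge on two inputs at a given time are equal or incomparable. -/
theorem transcript_eq_of_prefix (S : Strategy G B) (x x' : V → Fin B → Bool) (t : ℕ)
    (e : G.edgeSet) (h : S.transcript x t e <+: S.transcript x' t e) :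
    S.transcript x t e = S.transcript x' t e := by
  induction t generalizing x x' with
  | zero => rfl
  | succ t ih =>
    have heq : S.transcript x t e = S.transcript x' t e := by
      rcases List.prefix_or_prefix_of_prefix ((S.transcript_prefix_succ x t e).trans h)
        (S.transcript_prefix_succ x' t e) with h1 | h1
      · exact ih _ _ h1
      · exact (ih _ _ h1).symm
    -- With equal histories the schedule makes the same choice on both inputs, so the lengths grow
    -- equally.
    refine h.eq_of_length ?_
    cases hs : S.schedule e t (S.transcript x t e) with
    | none =>
      rw [S.transcript_succ_of_none hs, S.transcript_succ_of_none (heq ▸ hs), heq]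
    | some v =>
      rw [S.transcript_succ_of_some hs, S.transcript_succ_of_some (heq ▸ hs), heq]
      simp

/-- Both earlier transcripts are prefixes of one word, hence comparable, hence equal. -/
theorem transcript_eq_of_le (S : Strategy G B) {x x' : V → Fin B → Bool} {t t' : ℕ}
    {e : G.edgeSet} (htt' : t ≤ t') (h : S.transcript x t' e = S.transcript x' t' e) :
    S.transcript x t e = S.transcript x' t e := by
  rcases List.prefix_or_prefix_of_prefix (h ▸ S.transcript_prefix x htt' e)
    (S.transcript_prefix x' htt' e) with h1 | h1
  · exact S.transcript_eq_of_prefix _ _ _ _ h1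
  · exact (S.transcript_eq_of_prefix _ _ _ _ h1).symm

theorem transcript_succ_congr (S : Strategy G B) {x z : V → Fin B → Bool} {t : ℕ} {e : G.edgeSet}
    {v : {v : V // v ∈ e.1}} (hs : S.schedule e t (S.transcript x t e) = some v)
    (hv : z v.1 = x v.1)
    (h : ∀ e' : G.edgeSet, v.1 ∈ e'.1 → S.transcript z t e' = S.transcript x t e') :
    S.transcript z (t + 1) e = S.transcript x (t + 1) e := by
  have he := h e v.2
  rw [S.transcript_succ_of_some hs, S.transcript_succ_of_some (he ▸ hs), he, hv]
  congr 3
  funext e'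
  exact h e'.1 e'.2

/-- If two inputs give the same transcript on the only edge between `A` and its complement, then
the input that agrees with the first in `A` and with the second outside looks like the first in `A`
and like the second outside. -/
theorem transcript_mix (S : Strategy G B) {A : Set V} {e : G.edgeSet}
    (hA : ∀ e' ≠ e, ∀ v ∈ e'.1, ∀ w ∈ e'.1, v ∈ A → w ∈ A) {x x' z : V → Fin B → Bool}
    (hzA : ∀ v ∈ A, z v = x v) (hzA' : ∀ v ∉ A, z v = x' v) {T : ℕ}
    (hT : S.transcript x T e = S.transcript x' T e) {t : ℕ} (ht : t ≤ T) :
    (∀ e' : G.edgeSet, (∃ v ∈ e'.1, v ∈ A) → S.transcript z t e' = S.transcript x t e') ∧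
    (∀ e' : G.edgeSet, (∃ v ∈ e'.1, v ∉ A) → S.transcript z t e' = S.transcript x' t e') := by
  induction t with
  | zero => exact ⟨fun _ _ => rfl, fun _ _ => rfl⟩
  | succ t ih =>
    obtain ⟨ih1, ih2⟩ := ih (by omega)
    have hT1 := S.transcript_eq_of_le ht hT
    have hT0 := S.transcript_eq_of_le (Nat.le_of_succ_le ht) hT
    constructor
    · rintro e' ⟨v₀, hv₀, hv₀A⟩
      have heq := ih1 e' ⟨v₀, hv₀, hv₀A⟩
      cases hs : S.schedule e' t (S.transcript x t e') with
      | none => rw [S.transcript_succ_of_none hs, S.transcript_succ_of_none (heq ▸ hs), heq]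
      | some v =>
        by_cases hvA : v.1 ∈ A
        · exact S.transcript_succ_congr hs (hzA _ hvA) fun e'' he'' => ih1 e'' ⟨_, he'', hvA⟩
        -- An edge that meets `A` but has its sender outside `A` is the cut edge, where `x` and `x'`
        -- have the same transcript; the sender then behaves as on `x'`.
        · have hee : e' = e := by
            by_contra hne
            exact hvA (hA e' hne _ hv₀ _ v.2 hv₀A)
          subst hee
          rw [hT1]
          exact S.transcript_succ_congr (hT0 ▸ hs) (hzA' _ hvA)
            fun e'' he'' => ih2 e'' ⟨_, he'', hvA⟩
    · rintro e' ⟨v₀, hv₀, hv₀A⟩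
      have heq := ih2 e' ⟨v₀, hv₀, hv₀A⟩
      cases hs : S.schedule e' t (S.transcript x' t e') with
      | none => rw [S.transcript_succ_of_none hs, S.transcript_succ_of_none (heq ▸ hs), heq]
      | some v =>
        by_cases hvA : v.1 ∈ A
        · have hee : e' = e := by
            by_contra hne
            exact hv₀A (hA e' hne _ v.2 _ hv₀ hvA)
          subst hee
          rw [← hT1]
          exact S.transcript_succ_congr (hT0.symm ▸ hs) (hzA _ hvA)
            fun e'' he'' => ih1 e'' ⟨_, he'', hvA⟩
        · exact S.transcript_succ_congr hs (hzA' _ hvA) fun e'' he'' => ih2 e'' ⟨_, he'', hvA⟩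

/-- The rectangle property: two inputs with the same final transcript on a cut edge can be mixed
without changing the function values. -/
theorem Computes.value_mix {S : Strategy G B} {f : (V → Bool) → Bool} (hS : S.Computes f)
    {i j : V} (hij : G.Adj i j) {A : Set V} (hi : i ∈ A) (hj : j ∉ A)
    (hA : ∀ e' : G.edgeSet, e' ≠ ⟨s(i, j), hij⟩ → ∀ v ∈ e'.1, ∀ w ∈ e'.1, v ∈ A → w ∈ A)
    {x x' z : V → Fin B → Bool}
    (hzA : ∀ v ∈ A, z v = x v) (hzA' : ∀ v ∉ A, z v = x' v)
    (hT : S.transcript x S.horizon ⟨s(i, j), hij⟩ = S.transcript x' S.horizon ⟨s(i, j), hij⟩)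
    (k : Fin B) :
    f (fun w => z w k) = f (fun w => x w k) ∧ f (fun w => z w k) = f (fun w => x' w k) := by
  obtain ⟨h1, h2⟩ := S.transcript_mix hA hzA hzA' hT le_rfl
  constructor
  · rw [← hS z i k, ← hS x i k, hzA i hi]
    congr 1
    funext e'
    exact h1 e'.1 ⟨i, e'.2, hi⟩
  · rw [← hS z j k, ← hS x' j k, hzA' j hj]
    congr 1
    funext e'
    exact h2 e'.1 ⟨j, e'.2, hj⟩

theorem length_le_edgeCost [Fintype V] [DecidableEq V] (S : Strategy G B) (e : G.edgeSet)
    (x : V → Fin B → Bool) : (S.transcript x S.horizon e).length ≤ S.edgeCost e :=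
  Finset.le_sup (f := fun x : V → Fin B → Bool => (S.transcript x S.horizon e).length)
    (Finset.mem_univ x)

end Strategy

/-! ### Fooling set and lower bound -/

/-- The fooling set: numbers `x` of ones inside and `y` of ones outside with `x + y = θ` (left) or
`x + y = θ - 1` (right), indexed by `x`. -/
def fooling (θ d β : ℕ) : Finset (ℕ ⊕ ℕ) :=
  (Finset.Icc (θ - β) (min d θ)).disjSum (Finset.Ico (θ - (β + 1)) (min (d + 1) θ))

/-- The number of ones inside. -/
def foolingIn : ℕ ⊕ ℕ → ℕ := Sum.elim id id

/-- The number of ones outside. -/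
def foolingOut (θ : ℕ) : ℕ ⊕ ℕ → ℕ := Sum.elim (fun x => θ - x) (fun x => θ - 1 - x)

theorem card_fooling (θ d β : ℕ) : (fooling θ d β).card = states θ d β := by
  simp [fooling, states]

theorem foolingIn_le {θ d β : ℕ} {p : ℕ ⊕ ℕ} (hp : p ∈ fooling θ d β) : foolingIn p ≤ d := by
  rcases p with x | x <;> simp [fooling, foolingIn] at * <;> omega

theorem foolingOut_le {θ d β : ℕ} {p : ℕ ⊕ ℕ} (hp : p ∈ fooling θ d β) :
    foolingOut θ p ≤ β := by
  rcases p with x | x <;> simp [fooling, foolingOut] at * <;> omega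

/-- Pairs of different kinds have different values. For distinct pairs of the same kind, the two
mixed sums add up to `2θ` or `2(θ - 1)` and are unequal, so one of them lies on the wrong side of
the threshold. -/
theorem fooling_ext {θ d β : ℕ} {p q : ℕ ⊕ ℕ} (hp : p ∈ fooling θ d β) (hq : q ∈ fooling θ d β)
    (h1 : θ ≤ foolingIn p + foolingOut θ q ↔ θ ≤ foolingIn p + foolingOut θ p)
    (h2 : θ ≤ foolingIn p + foolingOut θ q ↔ θ ≤ foolingIn q + foolingOut θ q)
    (h3 : θ ≤ foolingIn q + foolingOut θ p ↔ θ ≤ foolingIn q + foolingOut θ q) : p = q := by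
  rcases p with x | x <;> rcases q with y | y <;>
    simp [fooling, foolingIn, foolingOut] at * <;> omega

section LowerBound

theorem exists_indicators {V : Type*} (A : Finset V) :
    ∃ s : ℕ → Finset V, (∀ m, s m ⊆ A) ∧ ∀ m ≤ A.card, (s m).card = m := by
  have : ∀ m, ∃ s ⊆ A, m ≤ A.card → s.card = m := by
    intro m
    by_cases h : m ≤ A.card
    · obtain ⟨s, hs, hm⟩ := Finset.exists_subset_card_eq h
      exact ⟨s, hs, fun _ => hm⟩
    · exact ⟨∅, Finset.empty_subset _, fun h' => (h h').elim⟩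
  choose s hs hm using this
  exact ⟨s, hs, hm⟩

variable {V : Type*} [Fintype V]

/-- On the two sides of a cut, the number of ones can be prescribed freely. -/
theorem exists_inputs [DecidableEq V] (A : Finset V) :
    ∃ g : ℕ → ℕ → V → Bool,
      (∀ m m' q, ∀ v ∈ A, g m q v = g m m' v) ∧ (∀ m m' q, ∀ v ∉ A, g m q v = g m' q v) ∧
      ∀ m q, m ≤ A.card → q ≤ Aᶜ.card → ∑ v, (g m q v).toNat = m + q := by
  obtain ⟨s, hs, hsc⟩ := exists_indicators A
  obtain ⟨s', hs', hsc'⟩ := exists_indicators Aᶜ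
  refine ⟨fun m q v => if v ∈ A then decide (v ∈ s m) else decide (v ∈ s' q), ?_, ?_, ?_⟩
  · intro m m' q v hv; simp [hv]
  · intro m m' q v hv; simp [hv]
  · intro m q hm hq
    rw [← Finset.sum_add_sum_compl A]
    congr 1
    · refine Eq.trans ?_ (hsc m hm)
      rw [Finset.card_eq_sum_ones, ← Finset.sum_subset (hs m)]
      · refine Finset.sum_congr rfl fun v hv => ?_
        simp [hs m hv, hv]
      · intro v hv hv'
        simp [hv, hv']
    · refine Eq.trans ?_ (hsc' q hq)
      rw [Finset.card_eq_sum_ones, ← Finset.sum_subset (hs' q)]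
      · refine Finset.sum_congr rfl fun v hv => ?_
        simp [Finset.mem_compl.1 (hs' q hv), hv]
      · intro v hv hv'
        simp [Finset.mem_compl.1 hv, hv']

/-- The fooling set is used independently in each of the `B` coordinates: inputs built from
different blocks of fooling pairs have different transcripts. -/
theorem states_pow_le_two_pow_edgeCost [DecidableEq V] {G : SimpleGraph V} (hG : G.IsTree)
    {θ B : ℕ} {S : Strategy G B} (hS : S.Computes (sumThreshold θ)) {i j : V} (hij : G.Adj i j) :
    states θ (side G i j).ncard (side G i j)ᶜ.ncard ^ B ≤ 2 ^ S.edgeCost ⟨s(i, j), hij⟩ := by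
  set A := sideFinset G i j with hAdef
  have hc : Aᶜ.card = (side G i j)ᶜ.ncard := by
    rw [compl_side hG hij, ← card_sideFinset, Finset.card_compl]
    have := card_sideFinset_add hG hij
    rw [← hAdef] at this
    omega
  rw [← card_sideFinset, ← hc, ← hAdef]
  obtain ⟨g, hgA, hgA', hg⟩ := exists_inputs A
  set Φ := {p // p ∈ fooling θ A.card Aᶜ.card} with hΦ
  -- `z φ φ` are the fooling inputs; `z φ ψ` is the mixture that follows `φ` inside the cut and `ψ`
  -- outside.
  let z : (Fin B → Φ) → (Fin B → Φ) → V → Fin B → Bool := fun φ ψ v k =>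
    g (foolingIn (φ k).1) (foolingOut θ (ψ k).1) v
  have hval : ∀ φ ψ k, sumThreshold θ (fun w => z φ ψ w k) =
      decide (θ ≤ foolingIn (φ k).1 + foolingOut θ (ψ k).1) := by
    intro φ ψ k
    rw [sumThreshold, hg _ _ (foolingIn_le (φ k).2) (foolingOut_le (ψ k).2)]
  have hcut : ∀ e' : G.edgeSet, e' ≠ ⟨s(i, j), hij⟩ → ∀ v ∈ e'.1, ∀ w ∈ e'.1,
      v ∈ side G i j → w ∈ side G i j := by
    rintro ⟨e', he'⟩ hne v hv w hw hvA
    by_cases hvw : v = w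
    · exact hvw ▸ hvA
    · have h1 : e' = s(v, w) := (Sym2.mem_and_mem_iff hvw).1 ⟨hv, hw⟩
      subst h1
      exact mem_side_of_adj he' (fun h => hne (Subtype.ext h)) hvA
  have hmix : ∀ φ ψ : Fin B → Φ, S.transcript (z φ φ) S.horizon ⟨s(i, j), hij⟩ =
      S.transcript (z ψ ψ) S.horizon ⟨s(i, j), hij⟩ → ∀ k,
      (θ ≤ foolingIn (φ k).1 + foolingOut θ (ψ k).1 ↔
        θ ≤ foolingIn (φ k).1 + foolingOut θ (φ k).1) ∧
      (θ ≤ foolingIn (φ k).1 + foolingOut θ (ψ k).1 ↔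
        θ ≤ foolingIn (ψ k).1 + foolingOut θ (ψ k).1) := by
    intro φ ψ hT k
    have := hS.value_mix hij (mem_side_self i j) (not_reachable_of_adj hG.isAcyclic hij) hcut
      (x := z φ φ) (x' := z ψ ψ) (z := z φ ψ) (fun v hv => funext fun k => hgA _ _ _ v (mem_sideFinset.2 hv))
      (fun v hv => funext fun k => hgA' _ _ _ v (fun h => hv (mem_sideFinset.1 h))) hT k
    simpa only [hval, decide_eq_decide] using this
  -- Padding with `false` loses nothing: equal padded words come from comparable transcripts, which
  -- are equal. Thus `2 ^ edgeCost` counts transcripts of all lengths.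
  let pad : (Fin B → Φ) → Fin (S.edgeCost ⟨s(i, j), hij⟩) → Bool := fun φ k =>
    (S.transcript (z φ φ) S.horizon ⟨s(i, j), hij⟩).getD k false
  have hinj : Function.Injective pad := by
    intro φ ψ h
    have hT : S.transcript (z φ φ) S.horizon ⟨s(i, j), hij⟩ =
        S.transcript (z ψ ψ) S.horizon ⟨s(i, j), hij⟩ := by
      rcases eq_of_getD_eq (S.length_le_edgeCost ⟨s(i, j), hij⟩ (z φ φ))
        (S.length_le_edgeCost ⟨s(i, j), hij⟩ (z ψ ψ))
        (fun k hk => congrFun h ⟨k, hk⟩) with h1 | h1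
      · exact S.transcript_eq_of_prefix _ _ _ _ h1
      · exact (S.transcript_eq_of_prefix _ _ _ _ h1).symm
    funext k
    obtain ⟨h1, h2⟩ := hmix φ ψ hT k
    obtain ⟨h3, h4⟩ := hmix ψ φ hT.symm k
    exact Subtype.ext (fooling_ext (φ k).2 (ψ k).2 h1 h2 h3)
  have := Fintype.card_le_of_injective pad hinj
  simpa [hΦ, card_fooling] using this

end LowerBound

/-! ### Executing a two-pass plan by a strategy -/

/-- A two-pass communication plan: on input `x`, each edge `e` carries the word `up e x`, sent by
`ch e` from slot `upTime e` on, and later the word `dn e x`, sent by `pa e` from slot `dnTime e`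
on. -/
structure Plan {V : Type*} (G : SimpleGraph V) (B : ℕ) where
  /-- The sender of the first word. -/
  ch : G.edgeSet → V
  /-- The sender of the second word. -/
  pa : G.edgeSet → V
  ch_mem : ∀ e : G.edgeSet, ch e ∈ e.1
  pa_mem : ∀ e : G.edgeSet, pa e ∈ e.1
  /-- The first word. -/
  up : G.edgeSet → (V → Fin B → Bool) → List Bool
  /-- The second word. -/
  dn : G.edgeSet → (V → Fin B → Bool) → List Bool
  /-- The first slot for the first word. -/
  upTime : G.edgeSet → ℕ
  /-- The first slot for the second word. -/
  dnTime : G.edgeSet → ℕ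
  /-- The number of slots reserved for each word. -/
  window : ℕ
  /-- The number of slots. -/
  horizon : ℕ

namespace Plan

variable {V : Type*} {G : SimpleGraph V} {B : ℕ}

/-- What should have been sent on `e` before slot `t`. -/
def target (P : Plan G B) (t : ℕ) (e : G.edgeSet) (x : V → Fin B → Bool) : List Bool :=
  (P.up e x).take (t - P.upTime e) ++ (P.dn e x).take (t - P.dnTime e)

/-- The node `v` cannot tell `x` from `x'` before slot `t`. -/
def Indist (P : Plan G B) (t : ℕ) (v : V) (x x' : V → Fin B → Bool) : Prop :=
  x v = x' v ∧ ∀ e : G.edgeSet, v ∈ e.1 → P.target t e x = P.target t e x'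

/-- The conditions under which the words of a plan can be parsed and fit into their windows. -/
structure WellTimed (P : Plan G B) : Prop where
  prefix_free : ∀ e x x', P.up e x <+: P.up e x' → P.up e x = P.up e x'
  dn_length : ∀ e x x', P.up e x = P.up e x' → (P.dn e x).length = (P.dn e x').length
  up_le : ∀ e x, (P.up e x).length ≤ P.window
  dn_le : ∀ e x, (P.dn e x).length ≤ P.window
  up_dn : ∀ e, P.upTime e + P.window ≤ P.dnTime e
  dn_horizon : ∀ e, P.dnTime e + P.window ≤ P.horizon

/-- The conditions under which a plan can be executed by a strategy that computes `f`. -/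
structure Valid (P : Plan G B) (f : (V → Bool) → Bool) : Prop extends WellTimed P where
  up_known : ∀ e t x x', P.upTime e ≤ t → t < P.upTime e + P.window →
    P.Indist t (P.ch e) x x' → P.up e x = P.up e x'
  dn_known : ∀ e t x x', P.dnTime e ≤ t → t < P.dnTime e + P.window →
    P.Indist t (P.pa e) x x' → P.dn e x = P.dn e x'
  value_known : ∀ v x x', P.Indist P.horizon v x x' →
    ∀ k, f (fun w => x w k) = f (fun w => x' w k)

open Classical in
/-- The strategy that executes a plan: the sender of a bit picks any input that is consistent with
what it has seen. -/
noncomputable def toStrategy (P : Plan G B) (f : (V → Bool) → Bool) : Strategy G B where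
  horizon := P.horizon
  schedule e t h :=
    -- The words are self-delimiting: the history on the edge alone shows whether the current word
    -- is complete.
    if P.upTime e ≤ t ∧ t < P.upTime e + P.window ∧ ¬ ∃ x, h = P.up e x then
      some ⟨P.ch e, P.ch_mem e⟩
    else if P.dnTime e ≤ t ∧ t < P.dnTime e + P.window ∧ ¬ ∃ x, h = P.up e x ++ P.dn e x then
      some ⟨P.pa e, P.pa_mem e⟩
    else none
  message v e hv t y h :=
    if hx : ∃ x : V → Fin B → Bool, x v = y ∧ ∀ e', h e' = P.target t e'.1 x then
      -- The next bit is at the index given by the number of bits already sent on `e`.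
      (P.target (t + 1) e hx.choose).getD (h ⟨e, hv⟩).length false
    else false
  decode v y h :=
    if hx : ∃ x : V → Fin B → Bool, x v = y ∧ ∀ e', h e' = P.target P.horizon e'.1 x then
      fun k => f fun w => hx.choose w k
    else fun _ => false

/-- The input chosen by the sender need not be the true one, but it is indistinguishable from it,
and `hx` says that such inputs prescribe the same bits. -/
theorem message_eq (P : Plan G B) (f : (V → Bool) → Bool) {v : V} {e : G.edgeSet} (hv : v ∈ e.1)
    {t : ℕ} {x : V → Fin B → Bool}
    (hx : ∀ x', P.Indist t v x' x → P.target (t + 1) e x' = P.target (t + 1) e x) :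
    (P.toStrategy f).message v e hv t (x v) (fun e' => P.target t e'.1 x) =
      (P.target (t + 1) e x).getD (P.target t e x).length false := by
  have h : ∃ x' : V → Fin B → Bool, x' v = x v ∧
      ∀ e' : {e' : G.edgeSet // v ∈ e'.1}, P.target t e'.1 x = P.target t e'.1 x' :=
    ⟨x, rfl, fun _ => rfl⟩
  simp only [toStrategy]
  rw [dif_pos h, hx _ ⟨h.choose_spec.1, fun e' he' => (h.choose_spec.2 ⟨e', he'⟩).symm⟩]

theorem decode_eq (P : Plan G B) (f : (V → Bool) → Bool) {v : V} {x : V → Fin B → Bool}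
    (hx : ∀ x', P.Indist P.horizon v x' x → ∀ k, f (fun w => x' w k) = f (fun w => x w k))
    (k : Fin B) :
    (P.toStrategy f).decode v (x v) (fun e' => P.target P.horizon e'.1 x) k =
      f (fun w => x w k) := by
  have h : ∃ x' : V → Fin B → Bool, x' v = x v ∧
      ∀ e' : {e' : G.edgeSet // v ∈ e'.1}, P.target P.horizon e'.1 x = P.target P.horizon e'.1 x' :=
    ⟨x, rfl, fun _ => rfl⟩
  simp only [toStrategy]
  rw [dif_pos h]
  exact hx _ ⟨h.choose_spec.1, fun e' he' => (h.choose_spec.2 ⟨e', he'⟩).symm⟩ k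

theorem transcript_succ_of_append (P : Plan G B) (f : (V → Bool) → Bool) {t : ℕ} {e : G.edgeSet}
    {x : V → Fin B → Bool} {v : {v // v ∈ e.1}} {b : Bool}
    (ih : ∀ e', (P.toStrategy f).transcript x t e' = P.target t e' x)
    (hs : (P.toStrategy f).schedule e t (P.target t e x) = some v)
    (hb : P.target (t + 1) e x = P.target t e x ++ [b])
    (hx : ∀ x', P.Indist t v.1 x' x → P.target (t + 1) e x' = P.target (t + 1) e x) :
    (P.toStrategy f).transcript x (t + 1) e = P.target (t + 1) e x := by
  rw [Strategy.transcript_succ_of_some _ ((ih e).symm ▸ hs)]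
  simp only [ih]
  rw [P.message_eq f v.2 hx, hb]
  simp

variable {P : Plan G B} {f : (V → Bool) → Bool}

theorem WellTimed.up_eq_of_append (hP : P.WellTimed) {e : G.edgeSet} {x x' : V → Fin B → Bool}
    {l l' : List Bool} (h : P.up e x ++ l = P.up e x' ++ l') : P.up e x = P.up e x' := by
  rcases List.prefix_or_prefix_of_prefix (List.prefix_append (P.up e x) l)
    (h ▸ List.prefix_append (P.up e x') l') with h1 | h1
  · exact hP.prefix_free _ _ _ h1
  · exact (hP.prefix_free _ _ _ h1).symm

theorem target_of_lt_dnTime {t : ℕ} {e : G.edgeSet} (ht : t ≤ P.dnTime e)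
    (x : V → Fin B → Bool) : P.target t e x = (P.up e x).take (t - P.upTime e) := by
  rw [target, Nat.sub_eq_zero_of_le ht, List.take_zero, List.append_nil]

theorem WellTimed.target_of_ge (hP : P.WellTimed) {t : ℕ} {e : G.edgeSet}
    (ht : P.upTime e + P.window ≤ t) (x : V → Fin B → Bool) :
    P.target t e x = P.up e x ++ (P.dn e x).take (t - P.dnTime e) := by
  rw [target, List.take_of_length_le (by have := hP.up_le e x; omega)]

theorem WellTimed.target_of_ge_of_le (hP : P.WellTimed) {t : ℕ} {e : G.edgeSet}
    (ht : P.upTime e + P.window ≤ t) (ht' : t ≤ P.dnTime e) (x : V → Fin B → Bool) :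
    P.target t e x = P.up e x := by
  rw [hP.target_of_ge ht, Nat.sub_eq_zero_of_le ht', List.take_zero, List.append_nil]

theorem WellTimed.target_of_ge_dn (hP : P.WellTimed) {t : ℕ} {e : G.edgeSet}
    (ht : P.dnTime e + P.window ≤ t) (x : V → Fin B → Bool) :
    P.target t e x = P.up e x ++ P.dn e x := by
  rw [hP.target_of_ge (by have := hP.up_dn e; omega),
    List.take_of_length_le (by have := hP.dn_le e x; omega)]

/-- The cases follow the position of `t` relative to the two windows and, within a window, whether
its word is already complete. -/
theorem Valid.transcript_eq (hP : P.Valid f) (x : V → Fin B → Bool) (t : ℕ) (e : G.edgeSet) :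
    (P.toStrategy f).transcript x t e = P.target t e x := by
  induction t generalizing e with
  | zero => simp [Strategy.transcript, target]
  | succ t ih =>
    have hud := hP.up_dn e
    have hul := hP.up_le e x
    have hdl := hP.dn_le e x
    have hnone : (P.toStrategy f).schedule e t (P.target t e x) = none →
        P.target (t + 1) e x = P.target t e x →
        (P.toStrategy f).transcript x (t + 1) e = P.target (t + 1) e x := by
      intro h1 h2
      rw [Strategy.transcript_succ_of_none _ ((ih e).symm ▸ h1), ih, h2]
    rcases lt_or_ge t (P.upTime e) with h1 | h1
    · refine hnone ?_ ?_
      · simp only [toStrategy]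
        rw [if_neg (by omega), if_neg (by omega)]
      · rw [target_of_lt_dnTime (by omega), target_of_lt_dnTime (by omega)]
        congr 1
        omega
    rcases lt_or_ge t (P.upTime e + P.window) with h2 | h2
    · rcases lt_or_ge (t - P.upTime e) (P.up e x).length with h3 | h3
      · have hsub : t + 1 - P.upTime e = t - P.upTime e + 1 := by omega
        refine P.transcript_succ_of_append f (v := ⟨P.ch e, P.ch_mem e⟩)
          (b := (P.up e x)[t - P.upTime e]) ih ?_ ?_ ?_
        · simp only [toStrategy]
          rw [if_pos]
          refine ⟨h1, h2, ?_⟩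
          rintro ⟨x', hx'⟩
          rw [target_of_lt_dnTime (by omega)] at hx'
          -- A proper prefix of a codeword is not a codeword, so the schedule does not stop early.
          have h4 := hP.prefix_free e x' x (hx' ▸ List.take_prefix _ _)
          have h5 := congrArg List.length hx'
          rw [h4, List.length_take] at h5
          omega
        · rw [target_of_lt_dnTime (by omega), target_of_lt_dnTime (by omega), hsub,
            List.take_succ_eq_append_getElem h3]
        · intro x' hx'
          rw [target_of_lt_dnTime (by omega), target_of_lt_dnTime (by omega),
            hP.up_known e t x' x h1 h2 hx']
      · have h4 : P.target t e x = P.up e x := by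
          rw [target_of_lt_dnTime (by omega), List.take_of_length_le h3]
        refine hnone ?_ ?_
        · simp only [toStrategy]
          rw [if_neg (fun h => h.2.2 ⟨x, h4⟩), if_neg (by omega)]
        · rw [h4, target_of_lt_dnTime (by omega), List.take_of_length_le (by omega)]
    rcases lt_or_ge t (P.dnTime e) with h3 | h3
    · refine hnone ?_ ?_
      · simp only [toStrategy]
        rw [if_neg (by omega), if_neg (by omega)]
      · rw [hP.target_of_ge_of_le h2 (by omega), hP.target_of_ge_of_le (by omega) (by omega)]
    rcases lt_or_ge t (P.dnTime e + P.window) with h4 | h4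
    · rcases lt_or_ge (t - P.dnTime e) (P.dn e x).length with h5 | h5
      · have hsub : t + 1 - P.dnTime e = t - P.dnTime e + 1 := by omega
        refine P.transcript_succ_of_append f (v := ⟨P.pa e, P.pa_mem e⟩)
          (b := (P.dn e x)[t - P.dnTime e]) ih ?_ ?_ ?_
        · simp only [toStrategy]
          rw [if_neg (by omega), if_pos]
          refine ⟨h3, h4, ?_⟩
          rintro ⟨x', hx'⟩
          rw [hP.target_of_ge h2] at hx'
          -- The first word determines the length of the second, so an incomplete reply cannot be
          -- mistaken for a complete one.
          have h6 := hP.up_eq_of_append hx'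
          have h7 := hP.dn_length e x x' h6
          have h8 := congrArg List.length hx'
          rw [List.length_append, List.length_append, h6, List.length_take] at h8
          omega
        · rw [hP.target_of_ge h2, hP.target_of_ge (by omega), hsub,
            List.take_succ_eq_append_getElem h5, List.append_assoc]
        · intro x' hx'
          have h6 := hx'.2 e (P.pa_mem e)
          rw [hP.target_of_ge h2, hP.target_of_ge h2] at h6
          rw [hP.target_of_ge (by omega), hP.target_of_ge (by omega), hP.up_eq_of_append h6,
            hP.dn_known e t x' x h3 h4 hx']
      · have h6 : P.target t e x = P.up e x ++ P.dn e x := by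
          rw [hP.target_of_ge h2, List.take_of_length_le h5]
        refine hnone ?_ ?_
        · simp only [toStrategy]
          rw [if_neg (by omega), if_neg (fun h => h.2.2 ⟨x, h6⟩)]
        · rw [h6, hP.target_of_ge (by omega), List.take_of_length_le (by omega)]
    · refine hnone ?_ ?_
      · simp only [toStrategy]
        rw [if_neg (by omega), if_neg (by omega)]
      · rw [hP.target_of_ge_dn h4, hP.target_of_ge_dn (by omega)]

theorem Valid.computes (hP : P.Valid f) : (P.toStrategy f).Computes f := by
  intro x v k
  have h : ∀ e, (P.toStrategy f).transcript x P.horizon e = P.target P.horizon e x :=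
    hP.transcript_eq x P.horizon
  have h' : (P.toStrategy f).horizon = P.horizon := rfl
  rw [h']
  simp only [h]
  exact P.decode_eq f (fun x' hx' => hP.value_known v x' x hx') k

theorem Valid.transcript_horizon (hP : P.Valid f) (x : V → Fin B → Bool) (e : G.edgeSet) :
    (P.toStrategy f).transcript x (P.toStrategy f).horizon e = P.up e x ++ P.dn e x := by
  rw [hP.transcript_eq]
  exact hP.target_of_ge_dn (hP.dn_horizon e) x

theorem transmits_toStrategy {x : V → Fin B → Bool} {t : ℕ} {u v : V}
    (h : (P.toStrategy f).Transmits x t u v) : ∃ e : G.edgeSet, e.1 = s(u, v) ∧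
      ((P.ch e = u ∧ P.upTime e ≤ t ∧ t < P.upTime e + P.window) ∨
       (P.pa e = u ∧ P.dnTime e ≤ t ∧ t < P.dnTime e + P.window)) := by
  obtain ⟨-, huv, hs⟩ := h
  refine ⟨⟨s(u, v), huv⟩, rfl, ?_⟩
  simp only [toStrategy] at hs
  split_ifs at hs with h1 h2
  · exact Or.inl ⟨congrArg Subtype.val (Option.some.inj hs), h1.1, h1.2.1⟩
  · exact Or.inr ⟨congrArg Subtype.val (Option.some.inj hs), h2.1, h2.2.1⟩

end Plan

/-! ### Coding blocks of clipped counts -/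

/-- The coordinates of a block of clipped counts that leave the function value open. -/
def pendingCount {B : ℕ} (θ β : ℕ) (κ : Fin B → ℕ) : ℕ :=
  ((List.finRange B).filter fun k => Pending θ β (κ k)).length

/-- This product form makes the Kraft sum over blocks factor into the `B`-th power of the sum in
`sum_weights`. -/
theorem two_pow_pendingCount {B : ℕ} (θ β : ℕ) (κ : Fin B → ℕ) :
    2 ^ pendingCount θ β κ = ∏ k, if Pending θ β (κ k) then 2 else 1 := by
  rw [Finset.prod_ite, Finset.prod_const, Finset.prod_const_one, mul_one]
  congr 1

/-- A prefix code for the blocks of clipped counts that leaves room for one more bit for each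
pending coordinate. -/
theorem exists_block_code {θ d β : ℕ} (h : θ ≤ d + β + 1) (B : ℕ) :
    ∃ c : (Fin B → ℕ) → List Bool,
      (∀ κ, (∀ k, κ k ∈ Finset.Icc (θ - (β + 1)) (min θ d)) →
        (c κ).length + pendingCount θ β κ = Nat.clog 2 (states θ d β ^ B)) ∧
      ∀ κ κ', (∀ k, κ k ∈ Finset.Icc (θ - (β + 1)) (min θ d)) →
        (∀ k, κ' k ∈ Finset.Icc (θ - (β + 1)) (min θ d)) → c κ <+: c κ' → κ = κ' := by
  obtain ⟨c, h1, h2⟩ := exists_prefix_code_on (pendingCount (B := B) θ β)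
    (Nat.clog 2 (states θ d β ^ B))
    (Fintype.piFinset fun _ => Finset.Icc (θ - (β + 1)) (min θ d)) (by
      simp only [two_pow_pendingCount]
      rw [Finset.sum_prod_piFinset _ fun _ l => if Pending θ β l then 2 else 1]
      simp only [sum_weights h, Finset.prod_const, Finset.card_univ, Fintype.card_fin]
      exact Nat.le_pow_clog (by norm_num) _)
  refine ⟨c, fun κ hκ => h1 κ (Fintype.mem_piFinset.2 hκ), fun κ κ' hκ hκ' => ?_⟩
  exact h2 κ (Fintype.mem_piFinset.2 hκ) κ' (Fintype.mem_piFinset.2 hκ')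

/-- The number of ones among the variables in `s`. -/
def ones {V : Type*} (s : Finset V) (x : V → Bool) : ℕ := ∑ v ∈ s, (x v).toNat

theorem ones_le_card {V : Type*} (s : Finset V) (x : V → Bool) : ones s x ≤ s.card := by
  rw [ones, Finset.card_eq_sum_ones]
  exact Finset.sum_le_sum fun v _ => Bool.toNat_le _

/-- Knowing more nodes can only lower the largest total still possible; this supplies the bounds
`hb` and `hb'` of `clip_add_sum_eq`. -/
theorem ones_add_card_le {V : Type*} {s t : Finset V} (h : s ⊆ t) (x : V → Bool) :
    ones t x + s.card ≤ ones s x + t.card := by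
  classical
  have h1 : ones (t \ s) x + ones s x = ones t x := Finset.sum_sdiff h
  have h2 := ones_le_card (t \ s) x
  have h3 := Finset.card_sdiff_add_card_eq_card h
  omega

/-! ### What clipped counts let a node deduce -/

section Rooted

variable {V : Type*} {G : SimpleGraph V}

theorem dist_lt_or_lt_of_adj (hG : G.IsTree) (r : V) {u v : V} (h : G.Adj u v) :
    G.dist r v < G.dist r u ∨ G.dist r u < G.dist r v := by
  by_cases hr : r ∈ side G v u
  · exact Or.inl (dist_lt_of_mem_side hG h hr)
  · refine Or.inr (dist_lt_of_mem_side hG h.symm ?_)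
    rw [← compl_side hG h.symm]
    exact hr

theorem parent_unique (hG : G.IsTree) {r v p q : V} (hp : G.Adj v p) (hq : G.Adj v q)
    (hpr : G.dist r p < G.dist r v) (hqr : G.dist r q < G.dist r v) : p = q := by
  refine (existsUnique_mem_side hG (v := v) (w := r) ?_).unique
    ⟨hp, (mem_side_iff_dist_lt hG hp).2 hpr⟩ ⟨hq, (mem_side_iff_dist_lt hG hq).2 hqr⟩
  rintro rfl
  simp at hpr

theorem exists_orientation (hG : G.IsTree) (r : V) (e : G.edgeSet) :
    ∃ q : V × V, G.Adj q.1 q.2 ∧ e.1 = s(q.1, q.2) ∧ G.dist r q.2 < G.dist r q.1 := by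
  obtain ⟨e, he⟩ := e
  induction e using Sym2.ind with
  | _ u v =>
    rcases dist_lt_or_lt_of_adj hG r he with h | h
    · exact ⟨(u, v), he, rfl, h⟩
    · exact ⟨(v, u), SimpleGraph.Adj.symm he, Sym2.eq_swap, h⟩

variable [Fintype V]

theorem side_subset_side (hG : G.IsTree) {u v p : V} (hu : G.Adj v u) (hp : G.Adj v p)
    (hne : u ≠ p) : sideFinset G u v ⊆ sideFinset G v p := by
  intro w hw
  rw [mem_sideFinset] at hw ⊢
  rw [← compl_side hG hp.symm]
  intro hw'
  refine hne ((existsUnique_mem_side hG (v := v) (w := w) ?_).unique ⟨hu, hw⟩ ⟨hp, hw'⟩)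
  rintro rfl
  exact not_reachable_of_adj hG.isAcyclic hu.symm hw

open Classical in
/-- The branch at `p` containing `v` splits into `v` and the other branches at `v`. -/
theorem ones_side_eq (hG : G.IsTree) {v p : V} (hp : G.Adj v p) (x : V → Bool) :
    ones (sideFinset G v p) x = (x v).toNat +
      ∑ u ∈ (Finset.univ.filter (G.Adj v)).erase p, ones (sideFinset G u v) x := by
  have h1 := sum_sideFinset_add hG hp fun w => (x w).toNat
  have h2 := sum_eq_add_sum_branches hG v fun w => (x w).toNat
  rw [← Finset.add_sum_erase _ _ (show p ∈ Finset.univ.filter (G.Adj v) by simpa using hp)] at h2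
  simp only [ones]
  omega

theorem ones_univ_eq (hG : G.IsTree) {v p : V} (hp : G.Adj v p) (x : V → Bool) :
    ones Finset.univ x = ones (sideFinset G v p) x + ones (sideFinset G p v) x :=
  (sum_sideFinset_add hG hp fun w => (x w).toNat).symm

/-- The clipped count of the part of the tree behind `u`, as seen from its neighbour `v`. -/
noncomputable def branchClip (G : SimpleGraph V) (θ : ℕ) (u v : V) (x : V → Bool) : ℕ :=
  clip θ (sideFinset G v u).card (ones (sideFinset G u v) x)

theorem branchClip_mem (hG : G.IsTree) {θ : ℕ} (hθ : θ ≤ Fintype.card V + 1) {u v : V}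
    (h : G.Adj u v) (x : V → Bool) : branchClip G θ u v x ∈
      Finset.Icc (θ - ((sideFinset G v u).card + 1)) (min θ (sideFinset G u v).card) := by
  refine clip_mem (ones_le_card _ _) ?_
  rw [card_sideFinset_add hG h]
  exact hθ

/-- A node that knows its own variable and the clipped counts of all branches but one knows the
clipped count of the union of these branches and itself. -/
theorem branchClip_congr (hG : G.IsTree) {θ : ℕ} {v p : V} (hp : G.Adj v p) {x x' : V → Bool}
    (hv : x v = x' v)
    (h : ∀ u, G.Adj v u → u ≠ p → branchClip G θ u v x = branchClip G θ u v x') :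
    branchClip G θ v p x = branchClip G θ v p x' := by
  classical
  have hb : ∀ x : V → Bool, ∀ u ∈ (Finset.univ.filter (G.Adj v)).erase p,
      (x v).toNat + ∑ u ∈ (Finset.univ.filter (G.Adj v)).erase p, ones (sideFinset G u v) x +
        (sideFinset G p v).card ≤ ones (sideFinset G u v) x + (sideFinset G v u).card := by
    intro x u hu
    have hu' : G.Adj v u := by simpa using (Finset.mem_erase.1 hu).2
    rw [← ones_side_eq hG hp]
    have h1 := ones_add_card_le (side_subset_side hG hu' hp (Finset.mem_erase.1 hu).1) x
    have h2 := card_sideFinset_add hG hu'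
    have h3 := card_sideFinset_add hG hp
    omega
  simp only [branchClip]
  have hb' := hb x'
  rw [ones_side_eq hG hp, ones_side_eq hG hp, ← hv]
  rw [← hv] at hb'
  refine clip_add_sum_eq _ _ _ (fun u => (sideFinset G v u).card) _ _ _ ?_ (hb x) hb'
  intro u hu
  exact h u (by simpa using (Finset.mem_erase.1 hu).2) (Finset.mem_erase.1 hu).1

/-- A node that knows its own variable and the clipped counts of all branches knows the value. -/
theorem sumThreshold_congr_of_branches (hG : G.IsTree) {θ : ℕ} {v : V} {x x' : V → Bool}
    (hv : x v = x' v) (h : ∀ u, G.Adj v u → branchClip G θ u v x = branchClip G θ u v x') :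
    sumThreshold θ x = sumThreshold θ x' := by
  classical
  have hb : ∀ x : V → Bool, ∀ u ∈ Finset.univ.filter (G.Adj v),
      (x v).toNat + ∑ u ∈ Finset.univ.filter (G.Adj v), ones (sideFinset G u v) x + 0 ≤
        ones (sideFinset G u v) x + (sideFinset G v u).card := by
    intro x u hu
    have hu' : G.Adj v u := by simpa using hu
    have h0 : ones Finset.univ x = _ :=
      sum_eq_add_sum_branches hG v fun w => (x w).toNat
    have h1 := ones_add_card_le (Finset.subset_univ (sideFinset G u v)) x
    have h2 := card_sideFinset_add hG hu'
    rw [Finset.card_univ] at h1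
    simp only [ones] at h0 h1 ⊢
    omega
  have hb' := hb x'
  rw [← hv] at hb'
  -- The union of `v` and all its branches is the whole tree, so `0` nodes remain outside.
  have h3 := clip_add_sum_eq (θ := θ) (Finset.univ.filter (G.Adj v))
    (fun u => ones (sideFinset G u v) x) (fun u => ones (sideFinset G u v) x')
    (fun u => (sideFinset G v u).card) (x v).toNat 0
    (fun u hu => h u (by simpa using hu)) (hb x) hb'
  have h4 := le_iff_of_clip_eq h3
  rw [sumThreshold, sumThreshold, sum_eq_add_sum_branches hG v fun w => (x w).toNat,
    sum_eq_add_sum_branches hG v fun w => (x' w).toNat, decide_eq_decide, ← hv]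
  exact h4

/-- If the value is not pending, it is determined by the clipped count of one branch. -/
theorem sumThreshold_congr_of_not_pending (hG : G.IsTree) {θ : ℕ} {v p : V} (hp : G.Adj v p)
    {x x' : V → Bool} (h : branchClip G θ v p x = branchClip G θ v p x')
    (hpend : ¬ Pending θ (sideFinset G p v).card (branchClip G θ v p x)) :
    sumThreshold θ x = sumThreshold θ x' := by
  have hpend' := hpend
  rw [h] at hpend'
  rw [branchClip, pending_clip] at hpend hpend'
  have h1 := le_add_iff_of_not_pending (ones_le_card (sideFinset G p v) x) hpend
  have h2 := le_add_iff_of_not_pending (ones_le_card (sideFinset G p v) x') hpend'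
  have h3 := le_iff_of_clip_eq h
  rw [← ones_univ_eq hG hp] at h1 h2
  rw [sumThreshold, sumThreshold, decide_eq_decide]
  exact h1.trans (h3.trans h2.symm)

end Rooted

/-! ### The up-then-down protocol -/

section Threshold

variable {V : Type*} {G : SimpleGraph V}

/-- The endpoint of an edge that is farther from the root. -/
noncomputable def child (hG : G.IsTree) (r : V) (e : G.edgeSet) : V :=
  (exists_orientation hG r e).choose.1

/-- The endpoint of an edge that is closer to the root. -/
noncomputable def parent (hG : G.IsTree) (r : V) (e : G.edgeSet) : V :=
  (exists_orientation hG r e).choose.2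

theorem adj_child_parent (hG : G.IsTree) (r : V) (e : G.edgeSet) :
    G.Adj (child hG r e) (parent hG r e) := (exists_orientation hG r e).choose_spec.1

theorem edge_eq (hG : G.IsTree) (r : V) (e : G.edgeSet) :
    e.1 = s(child hG r e, parent hG r e) := (exists_orientation hG r e).choose_spec.2.1

theorem dist_parent_lt (hG : G.IsTree) (r : V) (e : G.edgeSet) :
    G.dist r (parent hG r e) < G.dist r (child hG r e) :=
  (exists_orientation hG r e).choose_spec.2.2

theorem child_mem (hG : G.IsTree) (r : V) (e : G.edgeSet) : child hG r e ∈ e.1 :=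
  (congrArg (child hG r e ∈ ·) (edge_eq hG r e)).mpr (Sym2.mem_mk_left _ _)

theorem parent_mem (hG : G.IsTree) (r : V) (e : G.edgeSet) : parent hG r e ∈ e.1 :=
  (congrArg (parent hG r e ∈ ·) (edge_eq hG r e)).mpr (Sym2.mem_mk_right _ _)

theorem child_parent_eq (hG : G.IsTree) (r : V) {e : G.edgeSet} {u v : V} (he : e.1 = s(u, v))
    (h : G.dist r v < G.dist r u) : child hG r e = u ∧ parent hG r e = v := by
  have h1 := dist_parent_lt hG r e
  rw [edge_eq hG r e, Sym2.eq_iff] at he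
  rcases he with he | ⟨h2, h3⟩
  · exact he
  · rw [h2, h3] at h1
    omega

variable [Fintype V] {B : ℕ}

/-- The clipped counts below an edge, for all the instances of a block. -/
noncomputable def blockClip (hG : G.IsTree) (r : V) (θ : ℕ) (e : G.edgeSet)
    (x : V → Fin B → Bool) (k : Fin B) : ℕ :=
  branchClip G θ (child hG r e) (parent hG r e) fun w => x w k

/-- The number of nodes above an edge. -/
noncomputable def above (hG : G.IsTree) (r : V) (e : G.edgeSet) : ℕ :=
  (sideFinset G (parent hG r e) (child hG r e)).card

/-- The number of nodes below an edge. -/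
noncomputable def below (hG : G.IsTree) (r : V) (e : G.edgeSet) : ℕ :=
  (sideFinset G (child hG r e) (parent hG r e)).card

theorem below_add_above (hG : G.IsTree) (r : V) (e : G.edgeSet) :
    below hG r e + above hG r e = Fintype.card V :=
  card_sideFinset_add hG (adj_child_parent hG r e)

/-- The function values of the instances that are not decided by the clipped counts below an
edge. -/
noncomputable def reply (hG : G.IsTree) (r : V) (θ : ℕ) (e : G.edgeSet)
    (x : V → Fin B → Bool) : List Bool :=
  ((List.finRange B).filter fun k => Pending θ (above hG r e) (blockClip hG r θ e x k)).map
    fun k => sumThreshold θ fun w => x w k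

theorem length_reply (hG : G.IsTree) (r : V) (θ : ℕ) (e : G.edgeSet) (x : V → Fin B → Bool) :
    (reply hG r θ e x).length = pendingCount θ (above hG r e) (blockClip hG r θ e x) := by
  rw [reply, List.length_map, pendingCount]

/-- Equal clipped counts give the same list of undecided instances, so the reply bits line up; the
other values follow from the counts. -/
theorem value_eq_of_reply_eq (hG : G.IsTree) {r : V} {θ : ℕ} {e : G.edgeSet}
    {x x' : V → Fin B → Bool} (h : blockClip hG r θ e x = blockClip hG r θ e x')
    (hr : reply hG r θ e x = reply hG r θ e x') (k : Fin B) :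
    (sumThreshold θ fun w => x w k) = sumThreshold θ fun w => x' w k := by
  by_cases hk : Pending θ (above hG r e) (blockClip hG r θ e x k)
  · rw [reply, reply, ← h, List.map_inj_left] at hr
    exact hr k (by simpa using hk)
  · exact sumThreshold_congr_of_not_pending hG (adj_child_parent hG r e) (congrFun h k) hk

theorem reply_congr (hG : G.IsTree) {r : V} {θ : ℕ} {e : G.edgeSet}
    {x x' : V → Fin B → Bool} (h : blockClip hG r θ e x = blockClip hG r θ e x')
    (hv : ∀ k, (sumThreshold θ fun w => x w k) = sumThreshold θ fun w => x' w k) :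
    reply hG r θ e x = reply hG r θ e x' := by
  rw [reply, reply, ← h, List.map_inj_left]
  exact fun k _ => hv k

/-- The number of bits that an edge needs for a block. -/
noncomputable def edgeBits (hG : G.IsTree) (r : V) (θ B : ℕ) (e : G.edgeSet) : ℕ :=
  Nat.clog 2 (states θ (below hG r e) (above hG r e) ^ B)

/-- A longer reply is compensated by a shorter codeword, so the total on the edge does not depend on
the input. -/
theorem exists_edge_code (hG : G.IsTree) (r : V) {θ : ℕ} (hθ : θ ≤ Fintype.card V + 1) (B : ℕ)
    (e : G.edgeSet) : ∃ c : (V → Fin B → Bool) → List Bool,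
      (∀ x, (c x).length + (reply hG r θ e x).length = edgeBits hG r θ B e) ∧
      (∀ x x', c x <+: c x' → blockClip hG r θ e x = blockClip hG r θ e x') ∧
      ∀ x x', blockClip hG r θ e x = blockClip hG r θ e x' → c x = c x' := by
  obtain ⟨c, h1, h2⟩ := exists_block_code (θ := θ) (d := below hG r e) (β := above hG r e)
    (by rw [below_add_above]; exact hθ) B
  have hmem : ∀ (x : V → Fin B → Bool) k, blockClip hG r θ e x k ∈
      Finset.Icc (θ - (above hG r e + 1)) (min θ (below hG r e)) := fun x k =>
    branchClip_mem hG hθ (adj_child_parent hG r e) _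
  refine ⟨fun x => c (blockClip hG r θ e x), fun x => ?_, fun x x' h => ?_, fun x x' h => ?_⟩
  · rw [length_reply]
    exact h1 _ (hmem x)
  · exact h2 _ _ (hmem x) (hmem x') h
  · exact congrArg c h

theorem mul_add_le_mul {a b : ℕ} (h : a < b) (L : ℕ) : a * L + L ≤ b * L := by
  have := Nat.mul_le_mul_right L h
  rwa [Nat.succ_mul] at this

/-- The up-then-down plan: `D` bounds the depth of the tree, `L` the length of the words. -/
noncomputable def thresholdPlan (hG : G.IsTree) (r : V) (θ : ℕ)
    (c : G.edgeSet → (V → Fin B → Bool) → List Bool) (D L : ℕ) : Plan G B where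
  ch := child hG r
  pa := parent hG r
  ch_mem := child_mem hG r
  pa_mem := parent_mem hG r
  up := c
  dn := reply hG r θ
  -- Deeper edges come first on the way up and last on the way down; the deepest reply can start at
  -- `2 * D * L`, whence the horizon.
  upTime e := (D - G.dist r (child hG r e)) * L
  dnTime e := (D + G.dist r (child hG r e)) * L
  window := L
  horizon := (2 * D + 1) * L

section Knowledge

variable {hG : G.IsTree} {r : V} {θ : ℕ} {c : G.edgeSet → (V → Fin B → Bool) → List Bool}
  {D L : ℕ}
  (hc : ∀ e x x', c e x <+: c e x' → blockClip hG r θ e x = blockClip hG r θ e x')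
  (hc' : ∀ e x x', blockClip hG r θ e x = blockClip hG r θ e x' → c e x = c e x')
  (hlen : ∀ e x, (c e x).length + (reply hG r θ e x).length ≤ L)
  (hD : ∀ v, G.dist r v ≤ D)

include hc hc' hlen hD

theorem wellTimed_thresholdPlan : (thresholdPlan hG r θ c D L).WellTimed where
  prefix_free e x x' h := hc' e x x' (hc e x x' h)
  dn_length e x x' h := by
    have h' : c e x = c e x' := h
    have := hc e x x' (h' ▸ List.prefix_rfl)
    change (reply hG r θ e x).length = (reply hG r θ e x').length
    rw [length_reply, length_reply, this]
  up_le e x := (Nat.le_add_right _ _).trans (hlen e x)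
  dn_le e x := (Nat.le_add_left _ _).trans (hlen e x)
  up_dn e := mul_add_le_mul (by have := dist_parent_lt hG r e; omega) L
  dn_horizon e := mul_add_le_mul (by have := hD (child hG r e); omega) L

theorem blockClip_eq_of_indist {t : ℕ} {v : V} {x x' : V → Fin B → Bool}
    (h : (thresholdPlan hG r θ c D L).Indist t v x x') {e : G.edgeSet} (hv : v ∈ e.1)
    (ht : (D - G.dist r (child hG r e)) * L + L ≤ t) :
    blockClip hG r θ e x = blockClip hG r θ e x' := by
  have hW := wellTimed_thresholdPlan hc hc' hlen hD
  have h1 := h.2 e hv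
  rw [hW.target_of_ge ht, hW.target_of_ge ht] at h1
  have h2 : c e x = c e x' := hW.up_eq_of_append h1
  exact hc e x x' (h2 ▸ List.prefix_rfl)

theorem branchClip_eq_of_indist {t : ℕ} {v : V} {x x' : V → Fin B → Bool}
    (h : (thresholdPlan hG r θ c D L).Indist t v x x') {u : V} (hu : G.Adj v u)
    (hvu : G.dist r v < G.dist r u) (ht : (D - G.dist r v) * L ≤ t) (k : Fin B) :
    (branchClip G θ u v fun w => x w k) = branchClip G θ u v fun w => x' w k := by
  obtain ⟨h1, h2⟩ := child_parent_eq hG r (e := ⟨s(u, v), hu.symm⟩) rfl hvu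
  have := congrFun (blockClip_eq_of_indist hc hc' hlen hD h (e := ⟨s(u, v), hu.symm⟩)
    (Sym2.mem_mk_right u v) (by
      rw [h1]
      refine (mul_add_le_mul ?_ L).trans ht
      have := hD u
      omega)) k
  simpa only [blockClip, h1, h2] using this

theorem blockClip_eq_of_indist_child {t : ℕ} {e : G.edgeSet} {x x' : V → Fin B → Bool}
    (h : (thresholdPlan hG r θ c D L).Indist t (child hG r e) x x')
    (ht : (D - G.dist r (child hG r e)) * L ≤ t) :
    blockClip hG r θ e x = blockClip hG r θ e x' := by
  funext k
  refine branchClip_congr hG (adj_child_parent hG r e) (congrFun h.1 k) fun u hu hne => ?_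
  refine branchClip_eq_of_indist hc hc' hlen hD h hu ?_ ht k
  refine (dist_lt_or_lt_of_adj hG r hu).resolve_left fun hlt => hne ?_
  exact parent_unique hG hu (adj_child_parent hG r e) hlt (dist_parent_lt hG r e)

/-- A node with a parent combines its own clipped count with the reply from above. A node without
one has heard from every branch. The time bound is the end of the reply window of the edge to the
parent. -/
theorem value_eq_of_indist {t : ℕ} {v : V} {x x' : V → Fin B → Bool}
    (h : (thresholdPlan hG r θ c D L).Indist t v x x') (ht : (D + G.dist r v + 1) * L ≤ t)
    (k : Fin B) : (sumThreshold θ fun w => x w k) = sumThreshold θ fun w => x' w k := by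
  have htD : (D - G.dist r v) * L ≤ t := (Nat.mul_le_mul_right L (by omega)).trans ht
  by_cases hp : ∃ p, G.Adj v p ∧ G.dist r p < G.dist r v
  · obtain ⟨p, hp, hlt⟩ := hp
    have hW := wellTimed_thresholdPlan hc hc' hlen hD
    obtain ⟨h1, h2⟩ := child_parent_eq hG r (e := ⟨s(v, p), hp⟩) rfl hlt
    have h3 := blockClip_eq_of_indist_child hc hc' hlen hD (e := ⟨s(v, p), hp⟩) (h1.symm ▸ h)
      (h1.symm ▸ htD)
    refine value_eq_of_reply_eq hG h3 ?_ k
    have h4 := h.2 ⟨s(v, p), hp⟩ (Sym2.mem_mk_left v p)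
    have ht' : (thresholdPlan hG r θ c D L).dnTime ⟨s(v, p), hp⟩ +
        (thresholdPlan hG r θ c D L).window ≤ t := by
      refine (mul_add_le_mul ?_ L).trans ht
      rw [h1]
      omega
    rw [hW.target_of_ge_dn ht', hW.target_of_ge_dn ht'] at h4
    have h5 := hW.up_eq_of_append h4
    rw [h5] at h4
    exact List.append_cancel_left h4
  · push Not at hp
    refine sumThreshold_congr_of_branches hG (congrFun h.1 k) fun u hu => ?_
    refine branchClip_eq_of_indist hc hc' hlen hD h hu ?_ htD k
    exact (dist_lt_or_lt_of_adj hG r hu).resolve_left (by have := hp u hu; omega)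

theorem valid_thresholdPlan : (thresholdPlan hG r θ c D L).Valid (sumThreshold θ) where
  toWellTimed := wellTimed_thresholdPlan hc hc' hlen hD
  up_known e _ x x' ht _ h := hc' e x x' (blockClip_eq_of_indist_child hc hc' hlen hD h ht)
  dn_known e t x x' ht _ h := by
    -- The parent is strictly less deep than the child, so its own reply window is over when it
    -- starts to reply on `e`.
    have hlt : G.dist r ((thresholdPlan hG r θ c D L).pa e) < _ := dist_parent_lt hG r e
    refine reply_congr hG (blockClip_eq_of_indist hc hc' hlen hD h (parent_mem hG r e) ?_)
      (value_eq_of_indist hc hc' hlen hD h ?_)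
    · exact (mul_add_le_mul (by omega) L).trans ht
    · exact (Nat.mul_le_mul_right L (by omega)).trans ht
  value_known v x x' h := value_eq_of_indist hc hc' hlen hD h
    (Nat.mul_le_mul_right L (by have := hD v; omega))

omit hc hc' hlen in
-- A node at depth `m` transmits upwards only in window `D - m` and hears from above only in window
-- `D + m`, so the order of windows is the required order.
theorem isUpDown_thresholdPlan :
    ((thresholdPlan hG r θ c D L).toStrategy (sumThreshold θ)).IsUpDown r := by
  have hup : ∀ {x t u v}, G.dist r v < G.dist r u →
      ((thresholdPlan hG r θ c D L).toStrategy (sumThreshold θ)).Transmits x t u v →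
      (D - G.dist r u) * L ≤ t ∧ t < (D - G.dist r u) * L + L := by
    intro x t u v huv h
    obtain ⟨e, he, h | h⟩ := Plan.transmits_toStrategy h
    · obtain ⟨h1, h2⟩ := child_parent_eq hG r he huv
      have h3 := h.2
      simp only [thresholdPlan, h1] at h3
      exact h3
    · obtain ⟨h1, h2⟩ := child_parent_eq hG r he huv
      have h3 : parent hG r e = u := h.1
      rw [h2] at h3
      rw [h3] at huv
      omega
  have hdn : ∀ {x t u v}, G.dist r u < G.dist r v →
      ((thresholdPlan hG r θ c D L).toStrategy (sumThreshold θ)).Transmits x t u v →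
      (D + G.dist r v) * L ≤ t ∧ t < (D + G.dist r v) * L + L := by
    intro x t u v huv h
    obtain ⟨e, he, h | h⟩ := Plan.transmits_toStrategy h
    · obtain ⟨h1, h2⟩ := child_parent_eq hG r (he.trans Sym2.eq_swap) huv
      have h3 : child hG r e = u := h.1
      rw [h1] at h3
      rw [h3] at huv
      omega
    · obtain ⟨h1, h2⟩ := child_parent_eq hG r (he.trans Sym2.eq_swap) huv
      have h3 := h.2
      simp only [thresholdPlan, h1] at h3
      exact h3
  intro x v t t'
  refine ⟨fun c' p hc' hp h h' => ?_, fun p hp h h' => ?_, fun p c' hp hc' h h' => ?_,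
    fun c₁ c₂ h₁ h₂ h h' => ?_⟩
  · have h1 := hup hc' h
    have h2 := hup hp h'
    have h3 := mul_add_le_mul (a := D - G.dist r c') (b := D - G.dist r v)
      (by have := hD c'; omega) L
    omega
  · have h1 := hup hp h
    have h2 := hdn hp h'
    have h3 := mul_add_le_mul (a := D - G.dist r v) (b := D + G.dist r v) (by omega) L
    omega
  · have h1 := hdn hp h
    have h2 := hdn hc' h'
    have h3 := mul_add_le_mul (a := D + G.dist r v) (b := D + G.dist r c') (by omega) L
    omega
  · have h1 := hup h₁ h
    have h2 := hdn h₂ h'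
    have h3 := mul_add_le_mul (a := D - G.dist r c₁) (b := D + G.dist r c₂) (by omega) L
    omega

end Knowledge

/-- One up-then-down strategy that computes the threshold function with as few bits as possible on
every edge. -/
theorem exists_upDown_strategy [DecidableEq V] (hG : G.IsTree) {θ : ℕ}
    (hθ : θ ≤ Fintype.card V + 1) (B : ℕ) (r : V) :
    ∃ S : Strategy G B, S.Computes (sumThreshold θ) ∧ S.IsUpDown r ∧
      ∀ (i j : V) (hij : G.Adj i j), S.edgeCost ⟨s(i, j), hij⟩ ≤
        Nat.clog 2 (states θ (side G i j).ncard (side G i j)ᶜ.ncard ^ B) := by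
  choose c hlen hc hc' using exists_edge_code hG r hθ B
  obtain ⟨L, hL⟩ := (Set.finite_range (edgeBits hG r θ B)).bddAbove
  obtain ⟨D, hD⟩ := (Set.finite_range (G.dist r)).bddAbove
  have hD' : ∀ v, G.dist r v ≤ D := fun v => hD ⟨v, rfl⟩
  have hL' : ∀ e x, (c e x).length + (reply hG r θ e x).length ≤ L := fun e x =>
    (hlen e x).trans_le (hL ⟨e, rfl⟩)
  have hvalid := valid_thresholdPlan hc hc' hL' hD'
  refine ⟨_, hvalid.computes, isUpDown_thresholdPlan hD', fun i j hij => ?_⟩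
  have hbits : edgeBits hG r θ B ⟨s(i, j), hij⟩ =
      Nat.clog 2 (states θ (side G i j).ncard (side G i j)ᶜ.ncard ^ B) := by
    -- Either `i` or `j` may be the child; symmetry covers the second orientation.
    have hcomm := states_comm (θ := θ) (d := (sideFinset G i j).card)
      (β := (sideFinset G j i).card) (by rw [card_sideFinset_add hG hij]; exact hθ)
    rw [compl_side hG hij, ← card_sideFinset, ← card_sideFinset, edgeBits, below, above]
    rcases dist_lt_or_lt_of_adj hG r hij with h | h
    · obtain ⟨h1, h2⟩ := child_parent_eq hG r (e := ⟨s(i, j), hij⟩) rfl h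
      rw [h1, h2]
    · obtain ⟨h1, h2⟩ := child_parent_eq hG r (e := ⟨s(i, j), hij⟩) Sym2.eq_swap h
      rw [h1, h2, hcomm]
  rw [← hbits]
  refine Finset.sup_le fun x _ => ?_
  rw [hvalid.transcript_horizon, List.length_append]
  exact (hlen _ x).le

end Threshold

/-! ### From integer bit counts to rates -/

section Rate

variable {V : Type*} [Fintype V] {G : SimpleGraph V}

theorem mul_thresholdRate_eq (hG : G.IsTree) {θ : ℕ} (hθ : θ ≤ Fintype.card V + 1) {i j : V}
    (hij : G.Adj i j) (hle : (side G i j).ncard ≤ (side G i j)ᶜ.ncard) (B : ℕ) :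
    (B : ℝ) * thresholdRate (Fintype.card V) θ (side G i j).ncard =
      Real.logb 2 ((states θ (side G i j).ncard (side G i j)ᶜ.ncard ^ B : ℕ) : ℝ) := by
  have hn : (side G i j).ncard + (side G i j)ᶜ.ncard = Fintype.card V := by
    rw [compl_side hG hij, ← card_sideFinset, ← card_sideFinset, card_sideFinset_add hG hij]
  rw [thresholdRate_eq hn hθ hle, Nat.cast_pow, Real.logb_pow]

theorem ceil_mul_thresholdRate_eq (hG : G.IsTree) {θ : ℕ} (hθ : θ ≤ Fintype.card V + 1) {i j : V}
    (hij : G.Adj i j) (hle : (side G i j).ncard ≤ (side G i j)ᶜ.ncard) (B : ℕ) :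
    ⌈(B : ℝ) * thresholdRate (Fintype.card V) θ (side G i j).ncard⌉ =
      (Nat.clog 2 (states θ (side G i j).ncard (side G i j)ᶜ.ncard ^ B) : ℤ) := by
  rw [mul_thresholdRate_eq hG hθ hij hle]
  have := Real.ceil_logb_natCast (b := 2)
    (r := ((states θ (side G i j).ncard (side G i j)ᶜ.ncard ^ B : ℕ) : ℝ)) (by positivity)
  rw [Int.clog_natCast] at this
  exact_mod_cast this

theorem mul_thresholdRate_le_edgeCost [DecidableEq V] (hG : G.IsTree) {θ : ℕ}
    (hθ : θ ≤ Fintype.card V + 1) {B : ℕ} {S : Strategy G B}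
    (hS : S.Computes (sumThreshold θ)) {i j : V} (hij : G.Adj i j)
    (hle : (side G i j).ncard ≤ (side G i j)ᶜ.ncard) :
    (B : ℝ) * thresholdRate (Fintype.card V) θ (side G i j).ncard ≤
      (S.edgeCost ⟨s(i, j), hij⟩ : ℝ) := by
  have h1 : (Nat.clog 2 (states θ (side G i j).ncard (side G i j)ᶜ.ncard ^ B) : ℤ) ≤
      (S.edgeCost ⟨s(i, j), hij⟩ : ℤ) := by
    exact_mod_cast (Nat.clog_le_iff_le_pow (by norm_num)).2
      (states_pow_le_two_pow_edgeCost hG hS hij)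
  rw [← ceil_mul_thresholdRate_eq hG hθ hij hle, Int.ceil_le] at h1
  exact_mod_cast h1

/-- A quantity between `B * c` and `⌈B * c⌉` grows at rate `c`. -/
theorem tendsto_div_of_le_ceil {m : ℕ → ℕ} {c : ℝ} (h1 : ∀ B : ℕ, (B : ℝ) * c ≤ m B)
    (h2 : ∀ B : ℕ, (m B : ℤ) ≤ ⌈(B : ℝ) * c⌉) :
    Tendsto (fun B : ℕ => (m B : ℝ) / (B : ℝ)) atTop (𝓝 c) := by
  have hlim : Tendsto (fun B : ℕ => c + 1 / (B : ℝ)) atTop (𝓝 c) := by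
    simpa using tendsto_const_nhds.add (tendsto_one_div_atTop_nhds_zero_nat (𝕜 := ℝ))
  refine tendsto_of_tendsto_of_tendsto_of_le_of_le' tendsto_const_nhds hlim ?_ ?_
  · filter_upwards [eventually_gt_atTop 0] with B hB
    rw [le_div_iff₀ (by exact_mod_cast hB), mul_comm]
    exact h1 B
  · filter_upwards [eventually_gt_atTop 0] with B hB
    have hB' : (0 : ℝ) < B := by exact_mod_cast hB
    have h3 : ((m B : ℤ) : ℝ) ≤ (⌈(B : ℝ) * c⌉ : ℝ) := by exact_mod_cast h2 B
    have h4 := Int.ceil_lt_add_one ((B : ℝ) * c)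
    rw [div_le_iff₀ hB', add_mul, one_div_mul_cancel hB'.ne']
    push_cast at h3
    linarith

end Rate

end TreeNetwork

theorem theorem3 {V : Type*} [Fintype V] [DecidableEq V] (G : SimpleGraph V) (hG : G.IsTree)
    (θ : ℕ) (hθ : θ ≤ Fintype.card V + 1) :
    -- lower bound: every strategy, every edge
    (∀ (B : ℕ) (S : TreeNetwork.Strategy G B), S.Computes (TreeNetwork.sumThreshold θ) →
      ∀ (i j : V) (hij : G.Adj i j),
        (TreeNetwork.side G i j).ncard ≤ (TreeNetwork.side G i j)ᶜ.ncard →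
        (B : ℝ) * TreeNetwork.thresholdRate (Fintype.card V) θ (TreeNetwork.side G i j).ncard
          ≤ (S.edgeCost ⟨s(i, j), hij⟩ : ℝ)) ∧
    -- achievability: for every root, one up-then-down strategy for all the edges at once
    (∀ (B : ℕ) (r : V), ∃ S : TreeNetwork.Strategy G B,
      S.Computes (TreeNetwork.sumThreshold θ) ∧ S.IsUpDown r ∧
      ∀ (i j : V) (hij : G.Adj i j),
        (TreeNetwork.side G i j).ncard ≤ (TreeNetwork.side G i j)ᶜ.ncard →
        (S.edgeCost ⟨s(i, j), hij⟩ : ℤ) ≤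
          ⌈(B : ℝ) *
            TreeNetwork.thresholdRate (Fintype.card V) θ (TreeNetwork.side G i j).ncard⌉) ∧
    -- the per-instance complexity of every edge
    (∀ (i j : V) (hij : G.Adj i j),
      (TreeNetwork.side G i j).ncard ≤ (TreeNetwork.side G i j)ᶜ.ncard →
      TreeNetwork.HasEdgeComplexity G (TreeNetwork.sumThreshold θ) ⟨s(i, j), hij⟩
        (TreeNetwork.thresholdRate (Fintype.card V) θ (TreeNetwork.side G i j).ncard)) := by
  have hupper : ∀ (B : ℕ) (r : V), ∃ S : TreeNetwork.Strategy G B,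
      S.Computes (TreeNetwork.sumThreshold θ) ∧ S.IsUpDown r ∧
      ∀ (i j : V) (hij : G.Adj i j),
        (TreeNetwork.side G i j).ncard ≤ (TreeNetwork.side G i j)ᶜ.ncard →
        (S.edgeCost ⟨s(i, j), hij⟩ : ℤ) ≤
          ⌈(B : ℝ) *
            TreeNetwork.thresholdRate (Fintype.card V) θ (TreeNetwork.side G i j).ncard⌉ := by
    intro B r
    obtain ⟨S, hS, hud, hcost⟩ := TreeNetwork.exists_upDown_strategy hG hθ B r
    refine ⟨S, hS, hud, fun i j hij hle => ?_⟩
    rw [TreeNetwork.ceil_mul_thresholdRate_eq hG hθ hij hle]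
    exact_mod_cast hcost i j hij
  refine ⟨fun B S hS i j hij hle => TreeNetwork.mul_thresholdRate_le_edgeCost hG hθ hS hij hle,
    hupper, fun i j hij hle => TreeNetwork.tendsto_div_of_le_ceil (fun B => ?_) fun B => ?_⟩
  · obtain ⟨S, hS, -⟩ := hupper B i
    -- The least cost is attained, so the lower bound for individual strategies applies to it. Any
    -- root would serve for nonemptiness.
    obtain ⟨S', hS', hmin⟩ := Nat.sInf_mem
      (s := {c : ℕ | ∃ S : TreeNetwork.Strategy G B, S.Computes (TreeNetwork.sumThreshold θ) ∧
        S.edgeCost ⟨s(i, j), hij⟩ = c}) ⟨_, S, hS, rfl⟩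
    rw [TreeNetwork.minEdgeCost, ← hmin]
    exact TreeNetwork.mul_thresholdRate_le_edgeCost hG hθ hS' hij hle
  · obtain ⟨S, hS, -, hcost⟩ := hupper B i
    refine le_trans ?_ (hcost i j hij hle)
    rw [Nat.cast_le]
    exact Nat.sInf_le ⟨S, hS, rfl⟩
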